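/- **Stacks and automata.** Fix $n\ge 0$. Over an alphabet $X$, a $0$-stack is a symbol and, for $k\ge1$, a $k$-stack is a (possibly empty) list of nonempty $(k-1)$-stacks, with top on the right ($0$-stacks count as nonempty); $s^k:s^{k-1}$ is $s^k$ with $s^{k-1}$ put on top, and ":" associates to the right. For $1\le k\le n$, on nonempty $n$-stacks, $\mathsf{pop}^k(s^n:\dots:s^0)=s^n:\dots:s^k$ (defined if $s^k$ is nonempty) and $\mathsf{push}^k_\alpha(s^n:\dots:s^0)=s^n:\dots:s^{k+1}:(s^k:\dots:s^0):s^{k-1}:\dots:s^1:\alpha$. Let $\mathcal A$ be an $n$-DPDA with input alphabet $A$ containing a distinguished letter $\sharp$, stack alphabet $\Gamma$, finite state set $Q$ and transition function $\delta$, where $\delta(\gamma,p)$ is either $\mathsf{read}(\vec q)$ with $\vec q\colon A\to Q$ injective, or $(q,op)$ with $q\in Q$ and $op$ some $\mathsf{pop}^k$ or $\mathsf{push}^k_\alpha$. A configuration is a pair of a state and a nonempty $n$-stack over $\Gamma$. If $p$ is the state and $\gamma$ the topmost symbol of $c$, the successors of $c$ are: the configurations with the same stack and state $\vec q(a)$,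 $a\in A$, if $\delta(\gamma,p)=\mathsf{read}(\vec q)$ (such a step reads $a$); the configuration with state $q$ and stack obtained by applying $op$ (if defined), if $\delta(\gamma,p)=(q,op)$ (nothing is read). A run is a sequence $c_0,\dots,c_m$ with each $c_i$ a successor of $c_{i-1}$; $\sharp(\cdot)$ denotes the number of letters $\sharp$ that it reads. Let $\phi\colon A^*\to M$ be a morphism into a finite monoid. **Run descriptors.** For $0\le k\le n$ put $\mathcal T^k=Q\times\mathcal P(M\times\mathcal T^n)\times\dots\times\mathcal P(M\times\mathcal T^{k+1})\times\{\mathsf{np},\mathsf{pr}\}$. For $\sigma=(p,\Psi^n,\dots,\Psi^{k+1},f)\in\mathcal T^k$, $p$ is its state and $\mathsf{ass}^i(\sigma)=\Psi^i$ for $k<i\le n$; $\mathcal T_{\mathsf{np}},\mathcal T_{\mathsf{pr}}$ are the sets of descriptors with flag $\mathsf{np}$, $\mathsf{pr}$. For $\sigma=(p,\Psi^n,\dots,\Psi^{l+1},f)\in\mathcal T^l$ and $l\le k\le n$, $\mathsf{red}^k(\sigma)=(p,\Psi^n,\dots,\Psi^{k+1},g)$, where $g=\mathsf{np}$ iff $f=\mathsf{np}$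 and $\pi_2(\Psi^i)\subseteq\mathcal T_{\mathsf{np}}$ for $l<i\le k$. Write $m\circ\Psi=\{(mm',\sigma)\mid(m',\sigma)\in\Psi\}$. For $\Phi^i\subseteq M\times\mathcal T^i$ and $\Psi^k\subseteq M\times\mathcal T^k$, the tuple $(\Phi^k,\dots,\Phi^l;\Psi^k;f)$ is a composer if: $\Phi^i=\bigcup\{m\circ\mathsf{ass}^i(\sigma)\mid(m,\sigma)\in\Phi^l\}$ for $l<i\le k$; $\Psi^k=\{(m,\mathsf{red}^k(\sigma))\mid(m,\sigma)\in\Phi^l\}$; $|\pi_2(\Psi^k)|=|\pi_2(\Phi^l)|$; and $f=\mathsf{np}$ iff $\pi_2(\mathsf{ass}^i(\sigma))\cap\pi_2(\mathsf{ass}^i(\tau))\subseteq\mathcal T_{\mathsf{np}}$ for all $l<i\le k$ and all distinct $\sigma,\tau\in\pi_2(\Phi^l)$. **Derivation trees** $D$ for $\gamma\vdash\sigma$ (then $\mathsf{rd}(D)=\sigma$), and their depths, are defined inductively. (1) $(\mathsf{empty},\gamma,p)$ is one for $\gamma\vdash(p,\emptyset,\dots,\emptyset,\mathsf{np})$, of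 depth $0$. (2) If $\delta(\gamma,p)=\mathsf{read}(\vec q)$ and $D'$ is one for $\gamma\vdash\tau$ with $\tau$ of state $\vec q(a)$, then $(\mathsf{read},p,D')$ is one for $\gamma\vdash(p,\phi(a)\circ\mathsf{ass}^n(\tau),\dots,\phi(a)\circ\mathsf{ass}^1(\tau),f)$, where $f=\mathsf{np}$ iff $\tau\in\mathcal T_{\mathsf{np}}$ and $a\ne\sharp$; its depth is $1+\mathsf{depth}(D')$. (3) If $\delta(\gamma,p)=(q,\mathsf{pop}^k)$ and $\tau\in\mathcal T^k$ has state $q$, then $(\mathsf{pop},\gamma,p,\tau)$ is one for $\gamma\vdash(p,\mathsf{ass}^n(\tau),\dots,\mathsf{ass}^{k+1}(\tau),\{(1_M,\tau)\},\emptyset,\dots,\emptyset,\mathsf{np})$, of depth $0$. (4) Let $\delta(\gamma,p)=(q,\mathsf{push}^k_\alpha)$, let $D'$ be one for $\alpha\vdash\tau$ with $\tau$ of state $q$, let $\Psi^i=\mathsf{ass}^i(\tau)$, let $(\Phi^k,\dots,\Phi^0;\Psi^k;f)$ be a composer, and let $\mathfrak D$ be a set of derivation trees for $\gamma$ containing exactly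 one tree with run descriptor $\xi$ for each $\xi\in\pi_2(\Phi^0)$, and no other trees. Then $(\mathsf{push},\gamma,p,D',\mathfrak D)$ is one for $\gamma\vdash(p,\Upsilon^n,\dots,\Upsilon^1,g)$, where $\Upsilon^i=\Psi^i$ for $i>k$, $\Upsilon^k=\Phi^k$, $\Upsilon^i=\Psi^i\cup\Phi^i$ for $i<k$, and $g=\mathsf{np}$ iff $f=\mathsf{np}$, $\{\tau\}\cup\pi_2(\Phi^0)\subseteq\mathcal T_{\mathsf{np}}$ and $\pi_2(\Psi^i)\cap\pi_2(\Phi^i)\subseteq\mathcal T_{\mathsf{np}}$ for $1\le i<k$; its depth is $1+\max(\mathsf{depth}(D'),\max_{E\in\mathfrak D}\mathsf{depth}(E))$. **Annotated stacks.** An annotated $k$-stack is a $k$-stack over pairs $(\gamma,\mathfrak D)$, with $\mathfrak D$ a set of derivation trees for $\gamma$ with pairwise different run descriptors. Put $\mathsf{type}((\gamma,\mathfrak D))=\{\mathsf{rd}(D)\mid D\in\mathfrak D\}$, $\mathsf{type}([\,])=\emptyset$, $\mathsf{type}(s^k:s^{k-1})=\{\mathsf{red}^k(\sigma)\mid\sigma\in\mathsf{type}(s^{k-1})\}$.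 Annotated $0$-stacks and empty stacks are well-formed; $s^k:s^{k-1}$ is well-formed if $s^k$ and $s^{k-1}$ are, $\mathsf{type}(s^k)=\bigcup\{\pi_2(\mathsf{ass}^k(\sigma))\mid\sigma\in\mathsf{type}(s^{k-1})\}$ and $|\mathsf{type}(s^k:s^{k-1})|=|\mathsf{type}(s^{k-1})|$. A stack is singular if its type has one element; for a singular annotated $n$-stack $s$, $\mathsf{conf}(s)$ is the configuration whose state is that of the only descriptor in $\mathsf{type}(s)$ and whose stack is obtained from $s$ by replacing letters $(\gamma,\mathfrak D)$ by $\gamma$. The restriction $s{\restriction}_X$ of $s$ to $X\subseteq\mathsf{type}(s)$ keeps, for $k=0$, the trees $D$ with $\mathsf{rd}(D)\in X$; $[\,]{\restriction}_X=[\,]$; and $(s^k:s^{k-1}){\restriction}_X=s^k{\restriction}_{Z}:s^{k-1}{\restriction}_Y$ with $Y=\{\sigma\in\mathsf{type}(s^{k-1})\mid\mathsf{red}^k(\sigma)\in X\}$ and $Z=\bigcup_{\sigma\in Y}\pi_2(\mathsf{ass}^k(\sigma))$. **Annotated runs.** Let $s=s^n:\dots:s^1:(\gamma,\{D\})$ be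 well-formed and singular. In case (1) for $D$ it has no successor; in case (2) its successor is $s^n:\dots:s^1:(\gamma,\{D'\})$; in case (3) it is $s^n:\dots:s^k$; in case (4) it is $s^n:\dots:s^{k+1}:t^k:s^{k-1}{\restriction}_{\pi_2(\Psi^{k-1})}:\dots:s^1{\restriction}_{\pi_2(\Psi^1)}:(\alpha,\{D'\})$, where $t^k=s^k{\restriction}_{\pi_2(\Phi^k)}:\dots:s^1{\restriction}_{\pi_2(\Phi^1)}:(\gamma,\mathfrak D)$. An annotated run $R$ of length $|R|=m$ is a sequence $R(0),\dots,R(m)$ of well-formed singular annotated $n$-stacks, each $R(i)$, $i\ge1$, being the successor of $R(i-1)$; $\mathsf{st}(R)$ is the sequence $\mathsf{conf}(R(0)),\dots,\mathsf{conf}(R(m))$. **Measures.** Let $C_0=2$, $C_{z+1}=(2|\mathcal T^0|)^n\,C_z^{|\mathcal T^0|+1}$, and $\mathsf{pow}(a,b)=(1+a)^b-1$. Define $\mathsf{low}((\gamma,\mathfrak D))=|\{\mathsf{rd}(D)\mid D\in\mathfrak D\}\cap\mathcal T_{\mathsf{pr}}|$, $\mathsf{high}((\gamma,\mathfrak D))=\prod_{D\in\mathfrak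 D,\ \mathsf{rd}(D)\in\mathcal T_{\mathsf{pr}}}C_{\mathsf{depth}(D)}$, $\mathsf{len}((\gamma,\mathfrak D))=\prod_{D\in\mathfrak D}C_{\mathsf{depth}(D)}$; $\mathsf{low}([\,])=0$, $\mathsf{high}([\,])=\mathsf{len}([\,])=1$; and $$\mathsf{low}(s^k:s^{k-1})=\sum_{\sigma\in\mathsf{type}(s^{k-1})}\bigl(\mathsf{low}(s^k{\restriction}_{\pi_2(\mathsf{ass}^k(\sigma))})+\mathsf{low}(s^{k-1}{\restriction}_{\{\sigma\}})\bigr),$$ $$\mathsf{high}(s^k:s^{k-1})=\prod_{\sigma\in\mathsf{type}(s^{k-1})}\mathsf{pow}\bigl(\mathsf{high}(s^k{\restriction}_{\pi_2(\mathsf{ass}^k(\sigma))}),\mathsf{high}(s^{k-1}{\restriction}_{\{\sigma\}})\bigr),$$ and $\mathsf{len}(s^k:s^{k-1})$ by the same formula as $\mathsf{high}$, with $\mathsf{len}$ in place of $\mathsf{high}$. **Lemma.** For every annotated run $R$, $\mathsf{st}(R)$ is a run of $\mathcal A$, and $$\mathsf{low}(R(0))\le\sharp(\mathsf{st}(R))+\mathsf{low}(R(|R|)),$$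 $$\mathsf{high}(R(0))\ge\sharp(\mathsf{st}(R))+\mathsf{high}(R(|R|)),$$ $$\mathsf{len}(R(0))\ge|R|+\mathsf{len}(R(|R|)).$$ -/

import Mathlib

open scoped Classical

noncomputable section

namespace HOPDA

universe u v w x

/-! ### Higher-order stacks -/

/-- Raw higher-order stacks over `α`: a `0`-stack is a symbol, and a `(k+1)`-stack is a list of
`k`-stacks whose top is on the right. `nil k` is the empty `(k+1)`-stack `[]` and `cons s t` is
`s : t`, the stack `s` with the `k`-stack `t` put on its top. -/
inductive HOStack (α : Type u) : ℕ → Type u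
  | sym (a : α) : HOStack α 0
  | nil (k : ℕ) : HOStack α (k + 1)
  | cons {k : ℕ} (s : HOStack α (k + 1)) (t : HOStack α k) : HOStack α (k + 1)

namespace HOStack

variable {α : Type u} {β : Type v}

/-- A stack is nonempty; `0`-stacks count as nonempty. -/
def Nonempty : {k : ℕ} → HOStack α k → Prop
  | _, sym _ => True
  | _, nil _ => False
  | _, cons _ _ => True

/-- Stacks proper: every stack that is an element of another stack is nonempty. -/
def Proper : {k : ℕ} → HOStack α k → Prop
  | _, sym _ => True
  | _, nil _ => True
  | _, cons s t => s.Proper ∧ t.Proper ∧ t.Nonempty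

/-- Apply a function to every symbol of a stack. -/
def map (f : α → β) : {k : ℕ} → HOStack α k → HOStack β k
  | _, sym a => sym (f a)
  | _, nil k => nil k
  | _, cons s t => cons (s.map f) (t.map f)

/-- The topmost symbol. -/
def topSym : {k : ℕ} → HOStack α k → Option α
  | _, sym a => some a
  | _, nil _ => none
  | _, cons _ t => t.topSym

/-- Number of constructors; only used as a termination measure. -/
def nodes : {k : ℕ} → HOStack α k → ℕ
  | _, sym _ => 1
  | _, nil _ => 1
  | _, cons s t => s.nodes + t.nodes + 1

/-- `comp S l k` is `S k : S (k-1) : ⋯ : S l` (for `l ≤ k`), where `:` associates to the right. -/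
def comp (S : (i : ℕ) → HOStack α i) (l : ℕ) : (k : ℕ) → HOStack α k
  | 0 => S 0
  | k + 1 => if k + 1 ≤ l then S (k + 1) else cons (S (k + 1)) (comp S l k)

theorem map_nonempty (f : α → β) {k : ℕ} (s : HOStack α k) (h : s.Nonempty) :
    (s.map f).Nonempty := by
  cases s <;> simp_all [map, Nonempty]

theorem map_proper (f : α → β) {k : ℕ} (s : HOStack α k) (h : s.Proper) :
    (s.map f).Proper := by
  induction s with
  | sym a => simp [map, Proper]
  | nil k => simp [map, Proper]
  | cons s t ihs iht =>
    exact ⟨ihs h.1, iht h.2.1, map_nonempty f t h.2.2⟩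

end HOStack

/-! ### Pushdown automata of order `n` -/

/-- Stack operations of order at most `n`. -/
inductive StackOp (n : ℕ) (Γ : Type u) : Type u
  | pop (k : ℕ) (hk : 1 ≤ k) (hn : k ≤ n) : StackOp n Γ
  | push (k : ℕ) (hk : 1 ≤ k) (hn : k ≤ n) (γ : Γ) : StackOp n Γ

/-- `o.Apply s t` says that `o` is defined on the `n`-stack `s` and that its result is `t`. -/
def StackOp.Apply {n : ℕ} {Γ : Type u} : StackOp n Γ → HOStack Γ n → HOStack Γ n → Prop
  | .pop k _ _, s, t => ∃ S : (i : ℕ) → HOStack Γ i,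
      s = HOStack.comp S 0 n ∧ (S k).Nonempty ∧ t = HOStack.comp S k n
  | .push k _ _ γ, s, t => ∃ S : (i : ℕ) → HOStack Γ i,
      s = HOStack.comp S 0 n ∧
      t = HOStack.comp
        (Function.update (Function.update S 0 (.sym γ)) k (HOStack.comp S 0 k)) 0 n

/-- Values of the transition function. -/
inductive Transition (n : ℕ) (A : Type u) (Γ : Type v) (Q : Type w) : Type (max u v w)
  | read (r : A ↪ Q) : Transition n A Γ Q
  | op (q : Q) (o : StackOp n Γ) : Transition n A Γ Q

/-- Deterministic word-recognizing pushdown automata of order `n`. -/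
structure DPDA (n : ℕ) (A : Type u) (Γ : Type v) (Q : Type w) where
  initSym : Γ
  initState : Q
  accept : Set Q
  δ : Γ → Q → Transition n A Γ Q

/-- A configuration: a state and a nonempty `n`-stack. -/
structure Config (n : ℕ) (Γ : Type v) (Q : Type w) where
  state : Q
  stack : HOStack Γ n
  proper : stack.Proper
  nonempty : stack.Nonempty

namespace DPDA

variable {n : ℕ} {A : Type u} {Γ : Type v} {Q : Type w} (𝒜 : DPDA n A Γ Q)

/-- The transition `δ(c)` performed from `c`. -/
def trans (c : Config n Γ Q) : Option (Transition n A Γ Q) :=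
  c.stack.topSym.map fun γ => 𝒜.δ γ c.state

/-- `d` is a successor of `c`. -/
def IsSucc (c d : Config n Γ Q) : Prop :=
  (∃ (r : A ↪ Q) (a : A), 𝒜.trans c = some (.read r) ∧ d.state = r a ∧ d.stack = c.stack) ∨
  (∃ (q : Q) (o : StackOp n Γ), 𝒜.trans c = some (.op q o) ∧ d.state = q ∧
    o.Apply c.stack d.stack)

/-- The sequence `c 0, …, c m` is a run. -/
def IsRun {m : ℕ} (c : Fin (m + 1) → Config n Γ Q) : Prop :=
  ∀ i : Fin m, 𝒜.IsSucc (c i.castSucc) (c i.succ)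

/-- The word read in a step from `c` to its successor `d`. -/
def stepWord (c d : Config n Γ Q) : List A :=
  match 𝒜.trans c with
  | some (.read r) => if h : ∃ a, d.state = r a then [h.choose] else []
  | _ => []

/-- The word read by the run `c 0, …, c m`. -/
def word {m : ℕ} (c : Fin (m + 1) → Config n Γ Q) : List A :=
  (List.ofFn fun i : Fin m => 𝒜.stepWord (c i.castSucc) (c i.succ)).flatten

/-- The number of `sharp` symbols read by the run `c 0, …, c m`. -/
def sharps (sharp : A) {m : ℕ} (c : Fin (m + 1) → Config n Γ Q) : ℕ :=
  (𝒜.word c).count sharp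

end DPDA

/-! ### Run descriptors -/

/-- Productivity flags: nonproductive and productive. -/
inductive Flag : Type
  | np
  | pr

/-- The set `𝒯ᵏ` of run descriptors for `k`-stacks: a state, a subset of `M × 𝒯ⁱ` for every
`i ∈ {k+1, …, n}`, and a flag. (For finite `Q` and `M` all these sets are finite.) -/
def RunDesc (Q : Type u) (M : Type v) (n k : ℕ) : Type (max u v) :=
  Q × ((i : {i : ℕ // k < i ∧ i ≤ n}) → Finset (M × RunDesc Q M n i.1)) × Flag
termination_by n - k
decreasing_by have := i.2; omega

namespace RunDesc

variable {Q : Type u} {M : Type v} {n : ℕ}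

/-- The defining equation of `RunDesc`, as a bijection. -/
def equiv (Q : Type u) (M : Type v) (n k : ℕ) : RunDesc Q M n k ≃
    Q × ((i : {i : ℕ // k < i ∧ i ≤ n}) → Finset (M × RunDesc Q M n i.1)) × Flag :=
  Equiv.cast (by rw [RunDesc])

/-- The state of a run descriptor. -/
def state {k : ℕ} (σ : RunDesc Q M n k) : Q := (equiv Q M n k σ).1

/-- The productivity flag of a run descriptor. -/
def flag {k : ℕ} (σ : RunDesc Q M n k) : Flag := (equiv Q M n k σ).2.2

/-- The assumption set `assⁱ(σ)`, for `i ∈ {k+1, …, n}`; for other `i` it is empty by convention. -/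
def ass {k : ℕ} (σ : RunDesc Q M n k) (i : ℕ) : Finset (M × RunDesc Q M n i) :=
  if h : k < i ∧ i ≤ n then (equiv Q M n k σ).2.1 ⟨i, h⟩ else ∅

/-- The run descriptor in `𝒯ᵏ` with given state, assumption sets `Φ n, …, Φ (k+1)`, and flag. -/
def mk {k : ℕ} (p : Q) (Φ : (i : ℕ) → Finset (M × RunDesc Q M n i)) (f : Flag) :
    RunDesc Q M n k :=
  (equiv Q M n k).symm (p, fun i => Φ i.1, f)

/-- All run descriptors of `X` are nonproductive. -/
def AllNp {k : ℕ} (X : Finset (RunDesc Q M n k)) : Prop := ∀ σ ∈ X, σ.flag = .np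

/-- The projection `π₂`. -/
def pi2 {k : ℕ} (Ψ : Finset (M × RunDesc Q M n k)) : Finset (RunDesc Q M n k) :=
  Ψ.image Prod.snd

/-- `m ∘ Ψ`. -/
def act [Monoid M] {k : ℕ} (m : M) (Ψ : Finset (M × RunDesc Q M n k)) :
    Finset (M × RunDesc Q M n k) :=
  Ψ.image fun y => (m * y.1, y.2)

/-- The reduced run descriptor `redᵏ(σ) ∈ 𝒯ᵏ` of `σ ∈ 𝒯ˡ`, where `l ≤ k ≤ n`. -/
def red {l : ℕ} (k : ℕ) (σ : RunDesc Q M n l) : RunDesc Q M n k :=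
  mk σ.state σ.ass
    (if σ.flag = .np ∧ ∀ i, l < i → i ≤ k → AllNp (pi2 (σ.ass i)) then .np else .pr)

/-- `(Φ k, Φ (k-1), …, Φ l; Ψ; f)` is a composer (other values of `Φ` are irrelevant). -/
structure IsComposer [Monoid M] (l k : ℕ) (Φ : (i : ℕ) → Finset (M × RunDesc Q M n i))
    (Ψ : Finset (M × RunDesc Q M n k)) (f : Flag) : Prop where
  le : l ≤ k
  le_n : k ≤ n
  ass_eq : ∀ i, l < i → i ≤ k → Φ i = (Φ l).biUnion fun y => act y.1 (y.2.ass i)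
  red_eq : Ψ = (Φ l).image fun y => (y.1, red k y.2)
  card_eq : (pi2 Ψ).card = (pi2 (Φ l)).card
  flag_iff : f = .np ↔ ∀ i, l < i → i ≤ k → ∀ σ ∈ pi2 (Φ l), ∀ τ ∈ pi2 (Φ l), σ ≠ τ →
    AllNp (pi2 (σ.ass i) ∩ pi2 (τ.ass i))

end RunDesc

open RunDesc

/-! ### Derivation trees -/

section Types

variable {n : ℕ} {A : Type u} {Γ : Type v} {Q : Type w} {M : Type x} [Monoid M]

/-- `Deriv 𝒜 sharp φ γ σ` is the type of derivation trees for `γ ⊢ σ`. In the case `push`, the set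
of derivation trees attached to the composer contains exactly one tree for every element of
`π₂(Φ 0)`, so it is given as a function `E` on that set; the condition `hΦ` only fixes the unused
values of `Φ`. -/
inductive Deriv (𝒜 : DPDA n A Γ Q) (sharp : A) (φ : FreeMonoid A →* M) :
    Γ → RunDesc Q M n 0 → Type (max u v w x)
  | empty (γ : Γ) (p : Q) : Deriv 𝒜 sharp φ γ (RunDesc.mk p (fun _ => ∅) .np)
  | read (γ : Γ) (p : Q) (r : A ↪ Q) (hδ : 𝒜.δ γ p = .read r)
      (a : A) (τ : RunDesc Q M n 0) (hτ : τ.state = r a) (D' : Deriv 𝒜 sharp φ γ τ) :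
      Deriv 𝒜 sharp φ γ (RunDesc.mk p (fun i => act (φ (FreeMonoid.of a)) (τ.ass i))
        (if τ.flag = .np ∧ a ≠ sharp then .np else .pr))
  | pop (γ : Γ) (p q : Q) (k : ℕ) (hk : 1 ≤ k) (hn : k ≤ n)
      (hδ : 𝒜.δ γ p = .op q (.pop k hk hn)) (τ : RunDesc Q M n k) (hτ : τ.state = q) :
      Deriv 𝒜 sharp φ γ (RunDesc.mk p (Function.update τ.ass k {(1, τ)}) .np)
  | push (γ : Γ) (p q : Q) (k : ℕ) (hk : 1 ≤ k) (hn : k ≤ n) (α : Γ)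
      (hδ : 𝒜.δ γ p = .op q (.push k hk hn α))
      (τ : RunDesc Q M n 0) (hτ : τ.state = q) (D' : Deriv 𝒜 sharp φ α τ)
      (Φ : (i : ℕ) → Finset (M × RunDesc Q M n i)) (hΦ : ∀ i, k < i → Φ i = ∅) (f : Flag)
      (hcomp : IsComposer 0 k Φ (τ.ass k) f)
      (E : (σ : RunDesc Q M n 0) → σ ∈ pi2 (Φ 0) → Deriv 𝒜 sharp φ γ σ) :
      Deriv 𝒜 sharp φ γ (RunDesc.mk p
        (fun i => if i < k then τ.ass i ∪ Φ i else if i = k then Φ i else τ.ass i)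
        (if f = .np ∧ τ.flag = .np ∧ AllNp (pi2 (Φ 0)) ∧
            ∀ i, 1 ≤ i → i < k → AllNp (pi2 (τ.ass i) ∩ pi2 (Φ i)) then .np else .pr))

variable {𝒜 : DPDA n A Γ Q} {sharp : A} {φ : FreeMonoid A →* M}

/-- The depth of a derivation tree. -/
def Deriv.depth : {γ : Γ} → {σ : RunDesc Q M n 0} → Deriv 𝒜 sharp φ γ σ → ℕ
  | _, _, .empty _ _ => 0
  | _, _, .read _ _ _ _ _ _ _ D' => 1 + D'.depth
  | _, _, .pop _ _ _ _ _ _ _ _ _ => 0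
  | _, _, .push _ _ _ _ _ _ _ _ _ _ D' Φ _ _ _ E =>
      1 + max D'.depth ((pi2 (Φ 0)).attach.sup fun σ => (E σ.1 σ.2).depth)

variable (𝒜 sharp φ)

/-- Derivation trees with conclusion of the form `γ ⊢ σ`; the run descriptor `rd(D)` of `D` is its
first component. -/
abbrev DTree (γ : Γ) : Type (max u v w x) := (σ : RunDesc Q M n 0) × Deriv 𝒜 sharp φ γ σ

/-- Letters `(γ, 𝔇)` of annotated stacks. -/
structure AnnSym where
  sym : Γ
  trees : Finset (DTree 𝒜 sharp φ sym)
  inj : ∀ D ∈ trees, ∀ E ∈ trees, D.1 = E.1 → D = E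

/-- Annotated `k`-stacks (up to `HOStack.Proper`). -/
abbrev AnnStack (k : ℕ) := HOStack (AnnSym 𝒜 sharp φ) k

variable {𝒜 sharp φ}

/-! ### Annotated stacks -/

/-- `(γ, {D})`. -/
def AnnSym.single {γ : Γ} {σ : RunDesc Q M n 0} (D : Deriv 𝒜 sharp φ γ σ) :
    AnnSym 𝒜 sharp φ where
  sym := γ
  trees := {⟨σ, D⟩}
  inj := by
    intro D hD E hE _
    rw [Finset.mem_singleton] at hD hE
    rw [hD, hE]

/-- `(γ, 𝔇)` for the set `𝔇` of all `E σ`. -/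
def AnnSym.ofFun (γ : Γ) (X : Finset (RunDesc Q M n 0))
    (E : (σ : RunDesc Q M n 0) → σ ∈ X → Deriv 𝒜 sharp φ γ σ) : AnnSym 𝒜 sharp φ where
  sym := γ
  trees := X.attach.image fun σ => ⟨σ.1, E σ.1 σ.2⟩
  inj := by
    intro D hD F hF h
    simp only [Finset.mem_image, Finset.mem_attach, true_and] at hD hF
    obtain ⟨⟨σ, hσ⟩, rfl⟩ := hD
    obtain ⟨⟨τ, hτ⟩, rfl⟩ := hF
    simp only at h
    subst h
    rfl

/-- Keep only the trees whose run descriptors are in `X`. -/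
def AnnSym.restrict (s : AnnSym 𝒜 sharp φ) (X : Finset (RunDesc Q M n 0)) :
    AnnSym 𝒜 sharp φ where
  sym := s.sym
  trees := s.trees.filter fun D => D.1 ∈ X
  inj := fun D hD E hE h =>
    s.inj D (Finset.mem_filter.1 hD).1 E (Finset.mem_filter.1 hE).1 h

/-- The type of an annotated stack. -/
def type : {k : ℕ} → AnnStack 𝒜 sharp φ k → Finset (RunDesc Q M n k)
  | _, .sym a => a.trees.image Sigma.fst
  | _, .nil _ => ∅
  | _, .cons (k := k) _ t => (type t).image (red (k + 1))

/-- Well-formed annotated stacks. -/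
def WellFormed : {k : ℕ} → AnnStack 𝒜 sharp φ k → Prop
  | _, .sym _ => True
  | _, .nil _ => True
  | _, .cons (k := k) s t => WellFormed s ∧ WellFormed t ∧
      type s = (type t).biUnion (fun σ => pi2 (σ.ass (k + 1))) ∧
      (type (.cons s t)).card = (type t).card

/-- The restriction of an annotated stack to a subset `X` of its type. -/
def restrict : {k : ℕ} → AnnStack 𝒜 sharp φ k → Finset (RunDesc Q M n k) → AnnStack 𝒜 sharp φ k
  | _, .sym a, X => .sym (a.restrict X)
  | _, .nil k, _ => .nil k
  | _, .cons (k := k) s t, X =>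
      .cons
        (restrict s (((type t).filter fun σ => red (k + 1) σ ∈ X).biUnion
          fun σ => pi2 (σ.ass (k + 1))))
        (restrict t ((type t).filter fun σ => red (k + 1) σ ∈ X))

/-- Singular annotated stacks. -/
def Singular {k : ℕ} (s : AnnStack 𝒜 sharp φ k) : Prop := (type s).card = 1

theorem Singular.nonempty {k : ℕ} {s : AnnStack 𝒜 sharp φ k} (h : Singular s) : s.Nonempty := by
  cases s <;> simp_all [Singular, type, HOStack.Nonempty]

/-- The projection `st` of an annotated stack to a stack over `Γ`. -/
def st {k : ℕ} (s : AnnStack 𝒜 sharp φ k) : HOStack Γ k := s.map AnnSym.sym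

/-- The configuration `conf(s)`: its state is that of the only run descriptor in `type s`. -/
def conf (s : AnnStack 𝒜 sharp φ n) (hp : s.Proper) (hs : Singular s) : Config n Γ Q where
  state := (Finset.card_eq_one.1 hs).choose.state
  stack := st s
  proper := HOStack.map_proper _ s hp
  nonempty := HOStack.map_nonempty _ s hs.nonempty

/-! ### Annotated runs -/

/-- The successor of `S n : S (n-1) : ⋯ : S 0` where `S 0 = (γ, {D})`. -/
def Deriv.next (S : (i : ℕ) → AnnStack 𝒜 sharp φ i) :
    {γ : Γ} → {σ : RunDesc Q M n 0} → Deriv 𝒜 sharp φ γ σ → Option (AnnStack 𝒜 sharp φ n)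
  | _, _, .empty _ _ => none
  | _, _, .read _ _ _ _ _ _ _ D' =>
      some (HOStack.comp (Function.update S 0 (.sym (.single D'))) 0 n)
  | _, _, .pop _ _ _ k _ _ _ _ _ => some (HOStack.comp S k n)
  | γ, _, .push _ _ _ k _ _ _ _ τ _ D' Φ _ _ _ E =>
      let t : AnnStack 𝒜 sharp φ k := HOStack.comp
        (Function.update (fun i => restrict (S i) (pi2 (Φ i))) 0
          (.sym (.ofFun γ (pi2 (Φ 0)) E))) 0 k
      some (HOStack.comp
        (Function.update (Function.update
          (fun i => if i < k then restrict (S i) (pi2 (τ.ass i)) else S i)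
          0 (.sym (.single D'))) k t) 0 n)

/-- `t` is the successor of the (well-formed singular) annotated `n`-stack `s`. -/
def IsAnnSucc (s t : AnnStack 𝒜 sharp φ n) : Prop :=
  ∃ (S : (i : ℕ) → AnnStack 𝒜 sharp φ i) (γ : Γ) (σ : RunDesc Q M n 0)
    (D : Deriv 𝒜 sharp φ γ σ),
    s = HOStack.comp S 0 n ∧ S 0 = .sym (.single D) ∧ D.next S = some t

variable (𝒜 sharp φ)

/-- Annotated runs. -/
structure AnnRun where
  length : ℕ
  stk : Fin (length + 1) → AnnStack 𝒜 sharp φ n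
  proper : ∀ i, (stk i).Proper
  wellFormed : ∀ i, WellFormed (stk i)
  singular : ∀ i, Singular (stk i)
  succ : ∀ i : Fin length, IsAnnSucc (stk i.castSucc) (stk i.succ)

variable {𝒜 sharp φ}

/-- The sequence `st(R)` of configurations. -/
def AnnRun.st (R : AnnRun 𝒜 sharp φ) : Fin (R.length + 1) → Config n Γ Q :=
  fun i => conf (R.stk i) (R.proper i) (R.singular i)

/-! ### The functions low, high, len -/

/-- `pow() = 1` and `pow(m₁, m₂, …, mₖ) = (1 + m₁) ^ pow(m₂, …, mₖ) - 1`. -/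
def pow : List ℕ → ℕ
  | [] => 1
  | m :: l => (1 + m) ^ pow l - 1

/-- The constants `C_z`, where `t` stands for `|𝒯⁰|`. -/
def constC (n t : ℕ) : ℕ → ℕ
  | 0 => 2
  | z + 1 => (2 * t) ^ n * constC n t z ^ (t + 1)

/-- `C_{depth(D)}`. -/
def DTree.weight {γ : Γ} (D : DTree 𝒜 sharp φ γ) : ℕ :=
  constC n (Nat.card (RunDesc Q M n 0)) D.2.depth

theorem nodes_restrict {k : ℕ} (s : AnnStack 𝒜 sharp φ k) (X : Finset (RunDesc Q M n k)) :
    (restrict s X).nodes = s.nodes := by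
  induction s with
  | sym a => simp [restrict, HOStack.nodes]
  | nil k => simp [restrict, HOStack.nodes]
  | cons s t ihs iht => simp [restrict, HOStack.nodes, ihs, iht]

/-- The function `low`. -/
def low {k : ℕ} (s : AnnStack 𝒜 sharp φ k) : ℕ :=
  match k, s with
  | _, .sym a => ((type (.sym a)).filter fun σ => σ.flag = .pr).card
  | _, .nil _ => 0
  | _, .cons (k := k) s t =>
      ∑ σ ∈ type t, (low (restrict s (pi2 (σ.ass (k + 1)))) + low (restrict t {σ}))
termination_by s.nodes
decreasing_by all_goals (simp only [nodes_restrict, HOStack.nodes]; omega)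

/-- The common recursion of `high` and `len`, for given values on `0`-stacks. -/
def prodMeasure (base : AnnSym 𝒜 sharp φ → ℕ) {k : ℕ} (s : AnnStack 𝒜 sharp φ k) : ℕ :=
  match k, s with
  | _, .sym a => base a
  | _, .nil _ => 1
  | _, .cons (k := k) s t =>
      ∏ σ ∈ type t, pow [prodMeasure base (restrict s (pi2 (σ.ass (k + 1)))),
        prodMeasure base (restrict t {σ})]
termination_by s.nodes
decreasing_by all_goals (simp only [nodes_restrict, HOStack.nodes]; omega)

/-- The function `high`. -/
def high {k : ℕ} (s : AnnStack 𝒜 sharp φ k) : ℕ :=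
  prodMeasure (fun a => ∏ D ∈ a.trees with D.1.flag = .pr, D.weight) s

/-- The function `len`. -/
def len {k : ℕ} (s : AnnStack 𝒜 sharp φ k) : ℕ :=
  prodMeasure (fun a => ∏ D ∈ a.trees, D.weight) s

end Types

end HOPDA

end

namespace HOPDA

namespace HOStack

universe u v

variable {α : Type u} {β : Type v}

theorem comp_self (S : (i : ℕ) → HOStack α i) (l : ℕ) : comp S l l = S l := by
  cases l <;> simp [comp]

theorem comp_succ (S : (i : ℕ) → HOStack α i) {l k : ℕ} (h : l ≤ k) :
    comp S l (k + 1) = cons (S (k + 1)) (comp S l k) := by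
  simp [comp, Nat.not_le.2 (Nat.lt_succ_of_le h)]

theorem comp_congr {S T : (i : ℕ) → HOStack α i} {l k : ℕ} (hlk : l ≤ k)
    (h : ∀ i, l ≤ i → i ≤ k → S i = T i) : comp S l k = comp T l k := by
  induction k, hlk using Nat.le_induction with
  | base => rw [comp_self, comp_self, h l le_rfl le_rfl]
  | succ k hk ih =>
    rw [comp_succ S hk, comp_succ T hk, h (k + 1) (by omega) le_rfl,
      ih fun i hi hik => h i hi (by omega)]

theorem map_comp (f : α → β) (S : (i : ℕ) → HOStack α i) {l k : ℕ} (hlk : l ≤ k) :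
    (comp S l k).map f = comp (fun i => (S i).map f) l k := by
  induction k, hlk using Nat.le_induction with
  | base => rw [comp_self, comp_self]
  | succ k hk ih => rw [comp_succ _ hk, comp_succ _ hk, map, ih]

theorem topSym_comp (S : (i : ℕ) → HOStack α i) {l k : ℕ} (hlk : l ≤ k) :
    (comp S l k).topSym = (S l).topSym := by
  induction k, hlk using Nat.le_induction with
  | base => rw [comp_self]
  | succ k hk ih => rw [comp_succ _ hk, topSym, ih]

theorem nonempty_of_proper_comp (S : (i : ℕ) → HOStack α i) {l k : ℕ} (hlk : l ≤ k)
    (hp : (comp S l k).Proper) (hne : (comp S l k).Nonempty) : (S l).Nonempty := by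
  induction k, hlk using Nat.le_induction with
  | base => rwa [comp_self] at hne
  | succ k hk ih =>
    rw [comp_succ _ hk] at hp
    exact ih hp.2.1 hp.2.2

end HOStack

namespace RunDesc

universe u v

variable {Q : Type u} {M : Type v} {n k : ℕ}

@[simp]
theorem state_mk (p : Q) (Φ : (i : ℕ) → Finset (M × RunDesc Q M n i)) (f : Flag) :
    (mk p Φ f : RunDesc Q M n k).state = p := by
  simp [state, mk]

@[simp]
theorem flag_mk (p : Q) (Φ : (i : ℕ) → Finset (M × RunDesc Q M n i)) (f : Flag) :
    (mk p Φ f : RunDesc Q M n k).flag = f := by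
  simp [flag, mk]

theorem ass_mk (p : Q) (Φ : (i : ℕ) → Finset (M × RunDesc Q M n i)) (f : Flag) {i : ℕ}
    (hk : k < i) (hn : i ≤ n) : (mk p Φ f : RunDesc Q M n k).ass i = Φ i := by
  simp [ass, mk, hk, hn]

@[simp]
theorem state_red {l : ℕ} (σ : RunDesc Q M n l) : (red k σ).state = σ.state := by
  simp [red]

theorem ass_red {l : ℕ} (σ : RunDesc Q M n l) {i : ℕ} (hk : k < i) (hn : i ≤ n) :
    (red k σ).ass i = σ.ass i :=
  ass_mk _ _ _ hk hn

theorem flag_red_succ (σ : RunDesc Q M n k) :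
    (red (k + 1) σ).flag = .np ↔ σ.flag = .np ∧ AllNp (pi2 (σ.ass (k + 1))) := by
  rw [red, flag_mk]
  split_ifs with h
  · exact ⟨fun _ => ⟨h.1, h.2 _ (by omega) le_rfl⟩, fun _ => rfl⟩
  · refine ⟨fun h' => (by cases h'), fun h' => absurd ⟨h'.1, fun i h1 h2 => ?_⟩ h⟩
    obtain rfl : i = k + 1 := by omega
    exact h'.2

theorem pi2_act [Monoid M] (m : M) (Ψ : Finset (M × RunDesc Q M n k)) :
    pi2 (act m Ψ) = pi2 Ψ := by
  simp [pi2, act, Finset.image_image, Function.comp_def]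

theorem pi2_union (Ψ Φ : Finset (M × RunDesc Q M n k)) : pi2 (Ψ ∪ Φ) = pi2 Ψ ∪ pi2 Φ :=
  Finset.image_union _ _

theorem IsComposer.pi2_eq [Monoid M] {l : ℕ} {Φ : (i : ℕ) → Finset (M × RunDesc Q M n i)}
    {Ψ : Finset (M × RunDesc Q M n k)} {f : Flag} (h : IsComposer l k Φ Ψ f) {i : ℕ}
    (hl : l < i) (hk : i ≤ k) :
    pi2 (Φ i) = (pi2 (Φ l)).biUnion fun σ => pi2 (σ.ass i) := by
  rw [h.ass_eq i hl hk, pi2, Finset.biUnion_image, pi2, Finset.image_biUnion]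
  exact Finset.biUnion_congr rfl fun y _ => pi2_act _ _

/-- The descriptor in `𝒯ᵏ` obtained from `σ ∈ 𝒯⁰` by reducing through all levels in turn. -/
noncomputable def redIter (σ : RunDesc Q M n 0) : (k : ℕ) → RunDesc Q M n k
  | 0 => σ
  | k + 1 => red (k + 1) (redIter σ k)

theorem ass_redIter (σ : RunDesc Q M n 0) {i : ℕ} (hk : k < i) (hn : i ≤ n) :
    (redIter σ k).ass i = σ.ass i := by
  induction k with
  | zero => rfl
  | succ k ih => rw [redIter, ass_red _ hk hn, ih (by omega)]

instance instFinite [Finite Q] [Finite M] (k : ℕ) : Finite (RunDesc Q M n k) := by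
  induction h : n - k using Nat.strong_induction_on generalizing k with
  | _ d ih =>
    have : ∀ i : {i : ℕ // k < i ∧ i ≤ n}, Finite (RunDesc Q M n i.1) := fun i =>
      ih (n - i.1) (by have := i.2; omega) i.1 rfl
    have : Finite {i : ℕ // k < i ∧ i ≤ n} :=
      Set.Finite.subset (Set.finite_Iic n) fun i hi => hi.2
    have : Finite Flag :=
      Finite.of_injective (fun f : Flag => decide (f = .np)) fun f g h => by
        cases f <;> cases g <;> simp_all
    exact Finite.of_equiv _ (equiv Q M n k).symm

end RunDesc

theorem Flag.ne_np {f : Flag} : f ≠ .np ↔ f = .pr := by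
  cases f <;> simp

open RunDesc

universe u v w x

variable {n : ℕ} {A : Type u} {Γ : Type v} {Q : Type w} {M : Type x} [Monoid M]
variable {𝒜 : DPDA n A Γ Q} {sharp : A} {φ : FreeMonoid A →* M}

/-! ### Restrictions -/

theorem type_restrict {k : ℕ} (s : AnnStack 𝒜 sharp φ k) (X : Finset (RunDesc Q M n k)) :
    type (restrict s X) = type s ∩ X := by
  induction s with
  | sym a =>
    ext σ
    simp only [restrict, type, AnnSym.restrict, Finset.mem_image, Finset.mem_filter,
      Finset.mem_inter]
    constructor
    · rintro ⟨D, ⟨hD, hX⟩, rfl⟩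
      exact ⟨⟨D, hD, rfl⟩, hX⟩
    · rintro ⟨⟨D, hD, rfl⟩, hX⟩
      exact ⟨D, ⟨hD, hX⟩, rfl⟩
  | nil k => simp [restrict, type]
  | cons s t _ iht =>
    ext σ
    simp only [restrict, type, iht, Finset.mem_image, Finset.mem_filter, Finset.mem_inter]
    constructor
    · rintro ⟨ρ, ⟨h1, _, h2⟩, rfl⟩
      exact ⟨⟨ρ, h1, rfl⟩, h2⟩
    · rintro ⟨⟨ρ, h1, rfl⟩, h2⟩
      exact ⟨ρ, ⟨h1, h1, h2⟩, rfl⟩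

theorem type_restrict_of_subset {k : ℕ} {s : AnnStack 𝒜 sharp φ k}
    {X : Finset (RunDesc Q M n k)} (h : X ⊆ type s) : type (restrict s X) = X := by
  rw [type_restrict, Finset.inter_eq_right.2 h]

theorem WellFormed.injOn {k : ℕ} {s : AnnStack 𝒜 sharp φ (k + 1)} {t : AnnStack 𝒜 sharp φ k}
    (h : WellFormed (.cons s t)) : Set.InjOn (red (k + 1)) (type t : Set (RunDesc Q M n k)) :=
  Finset.card_image_iff.1 h.2.2.2

theorem WellFormed.restrict {k : ℕ} {s : AnnStack 𝒜 sharp φ k} (h : WellFormed s)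
    (X : Finset (RunDesc Q M n k)) : WellFormed (restrict s X) := by
  induction s with
  | sym a => trivial
  | nil k => trivial
  | cons s t ihs iht =>
    have hsub : ((type t).filter fun σ => red _ σ ∈ X) ⊆ type t := Finset.filter_subset _ _
    refine ⟨ihs h.1 _, iht h.2.1 _, ?_, ?_⟩
    · rw [type_restrict_of_subset hsub, type_restrict_of_subset]
      rw [h.2.2.1]
      exact Finset.biUnion_subset_biUnion_of_subset_left _ hsub
    · rw [type, type_restrict_of_subset hsub]
      exact Finset.card_image_iff.2 (h.injOn.mono (Finset.coe_subset.2 hsub))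

theorem restrict_eq_self {k : ℕ} {s : AnnStack 𝒜 sharp φ k} (h : WellFormed s)
    {X : Finset (RunDesc Q M n k)} (hX : type s ⊆ X) : restrict s X = s := by
  induction s with
  | sym a =>
    have : a.trees.filter (fun D => D.1 ∈ X) = a.trees :=
      Finset.filter_true_of_mem fun D hD => hX (Finset.mem_image_of_mem _ hD)
    cases a
    simp only [restrict, AnnSym.restrict] at this ⊢
    congr
  | nil k => rfl
  | cons s t ihs iht =>
    have : (type t).filter (fun σ => red _ σ ∈ X) = type t :=
      Finset.filter_true_of_mem fun D hD => hX (Finset.mem_image_of_mem _ hD)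
    rw [restrict, this, iht h.2.1 subset_rfl, ihs h.1 h.2.2.1.subset]

theorem restrict_restrict {k : ℕ} (s : AnnStack 𝒜 sharp φ k) (X Y : Finset (RunDesc Q M n k)) :
    restrict (restrict s X) Y = restrict s (X ∩ Y) := by
  induction s with
  | sym a => simp [restrict, AnnSym.restrict, Finset.filter_filter]
  | nil k => rfl
  | cons s t ihs iht =>
    rw [restrict, restrict, restrict, ihs, iht, type_restrict_of_subset (Finset.filter_subset _ _),
      Finset.filter_filter]
    simp only [Finset.mem_inter]
    rw [Finset.inter_eq_right.2, Finset.inter_eq_right.2]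
    · exact Finset.monotone_filter_right _ fun σ _ h => h.1
    · exact Finset.biUnion_subset_biUnion_of_subset_left _
        (Finset.monotone_filter_right _ fun σ _ h => h.1)

theorem restrict_restrict_of_subset {k : ℕ} (s : AnnStack 𝒜 sharp φ k)
    {X Y : Finset (RunDesc Q M n k)} (h : Y ⊆ X) :
    restrict (restrict s X) Y = restrict s Y := by
  rw [restrict_restrict, Finset.inter_eq_right.2 h]

theorem restrict_cons_singleton {k : ℕ} {s : AnnStack 𝒜 sharp φ (k + 1)}
    {t : AnnStack 𝒜 sharp φ k} (h : WellFormed (.cons s t)) {σ : RunDesc Q M n k}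
    (hσ : σ ∈ type t) : restrict (.cons s t) {red (k + 1) σ} =
      .cons (restrict s (pi2 (σ.ass (k + 1)))) (restrict t {σ}) := by
  have : (type t).filter (fun ρ => red (k + 1) ρ ∈ ({red (k + 1) σ} : Finset _)) = {σ} := by
    ext ρ
    simp only [Finset.mem_filter, Finset.mem_singleton]
    exact ⟨fun hρ => h.injOn hρ.1 hσ hρ.2, fun hρ => by subst hρ; exact ⟨hσ, rfl⟩⟩
  rw [restrict, this, Finset.singleton_biUnion]

theorem st_restrict {k : ℕ} (s : AnnStack 𝒜 sharp φ k) (X : Finset (RunDesc Q M n k)) :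
    st (restrict s X) = st s := by
  induction s with
  | sym a => rfl
  | nil k => rfl
  | cons s t ihs iht => simp only [st, restrict, HOStack.map] at *; rw [ihs, iht]

/-! ### Composed stacks -/

section Comp

open HOStack

variable {S : (i : ℕ) → AnnStack 𝒜 sharp φ i} {l k : ℕ}

theorem WellFormed.of_comp (hlk : l ≤ k) (h : WellFormed (comp S l k)) {i : ℕ} (hl : l ≤ i)
    (hk : i ≤ k) : WellFormed (S i) := by
  induction k, hlk using Nat.le_induction with
  | base =>
    obtain rfl : i = l := by omega
    rwa [comp_self] at h
  | succ k hlk ih =>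
    rw [comp_succ _ hlk] at h
    rcases Nat.lt_or_ge k i with hi | hi
    · obtain rfl : i = k + 1 := by omega
      exact h.1
    · exact ih h.2.1 hi

theorem card_type_comp (hlk : l ≤ k) (h : WellFormed (comp S l k)) :
    (type (comp S l k)).card = (type (S l)).card := by
  induction k, hlk using Nat.le_induction with
  | base => rw [comp_self]
  | succ k hlk ih =>
    rw [comp_succ _ hlk] at h ⊢
    rw [h.2.2.2, ih h.2.1]

theorem type_comp (S : (i : ℕ) → AnnStack 𝒜 sharp φ i) (k : ℕ) :
    type (comp S 0 k) = (type (S 0)).image fun σ => redIter σ k := by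
  induction k with
  | zero => simp [comp, redIter]
  | succ k ih =>
    rw [comp_succ _ (Nat.zero_le k), type, ih, Finset.image_image]
    rfl

theorem exists_state_eq_of_mem_type_comp (hlk : l ≤ k) {ρ : RunDesc Q M n k}
    (hρ : ρ ∈ type (comp S l k)) : ∃ σ ∈ type (S l), ρ.state = σ.state := by
  induction k, hlk using Nat.le_induction with
  | base =>
    rw [comp_self] at hρ
    exact ⟨ρ, hρ, rfl⟩
  | succ k hlk ih =>
    rw [comp_succ _ hlk] at hρ
    obtain ⟨ρ', hρ', rfl⟩ := Finset.mem_image.1 hρ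
    rw [state_red]
    exact ih hρ'

theorem injOn_redIter (h : WellFormed (comp S 0 k)) :
    Set.InjOn (fun σ => redIter σ k) (type (S 0) : Set (RunDesc Q M n 0)) := by
  apply Finset.card_image_iff.1
  rw [← type_comp, card_type_comp (Nat.zero_le k) h]

theorem type_eq_of_comp (hkn : k ≤ n) (h : WellFormed (comp S 0 k)) {i : ℕ} (hi : 0 < i)
    (hik : i ≤ k) : type (S i) = (type (S 0)).biUnion fun σ => pi2 (σ.ass i) := by
  induction k with
  | zero => omega
  | succ k ih =>
    rw [comp_succ _ (Nat.zero_le k)] at h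
    rcases Nat.lt_or_ge k i with hi | hi
    · obtain rfl : i = k + 1 := by omega
      rw [h.2.2.1, type_comp, Finset.image_biUnion]
      refine Finset.biUnion_congr rfl fun σ _ => ?_
      rw [ass_redIter _ (by omega) hkn]
    · exact ih (by omega) h.2.1 hi

theorem restrict_comp (hkn : k ≤ n) (h : WellFormed (comp S 0 k)) {ξ : RunDesc Q M n 0}
    (hξ : ξ ∈ type (S 0)) : restrict (comp S 0 k) {redIter ξ k} =
      comp (Function.update (fun i => restrict (S i) (pi2 (ξ.ass i))) 0 (restrict (S 0) {ξ})) 0 k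
    := by
  induction k with
  | zero => simp [comp, redIter]
  | succ k ih =>
    rw [comp_succ _ (Nat.zero_le k)] at h
    rw [comp_succ _ (Nat.zero_le k), comp_succ _ (Nat.zero_le k), redIter,
      restrict_cons_singleton h, ih (by omega) h.2.1, Function.update_of_ne (by omega),
      ass_redIter _ (by omega) hkn]
    rw [type_comp]
    exact Finset.mem_image_of_mem _ hξ

end Comp

/-! ### Measures -/

/-- The common recursion of `low`, `high` and `len`. -/
structure StackMeasure {N : Type*} [CommMonoid N] (op : N → N → N)
    (w : (γ : Γ) → DTree 𝒜 sharp φ γ → N) (μ : (k : ℕ) → AnnStack 𝒜 sharp φ k → N) : Prop where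
  sym : ∀ a : AnnSym 𝒜 sharp φ, μ 0 (.sym a) = ∏ D ∈ a.trees, w a.sym D
  nil : ∀ k, μ (k + 1) (.nil k) = 1
  cons : ∀ {k : ℕ} (s : AnnStack 𝒜 sharp φ (k + 1)) (t : AnnStack 𝒜 sharp φ k),
    μ (k + 1) (.cons s t) = ∏ σ ∈ type t,
      op (μ (k + 1) (restrict s (pi2 (σ.ass (k + 1))))) (μ k (restrict t {σ}))

/-- `iterOp op a l k` is `op (a k) (op (a (k-1)) … (op (a (l+1)) (a l)))` (for `l ≤ k`). -/
def iterOp {N : Type*} (op : N → N → N) (a : ℕ → N) (l : ℕ) : ℕ → N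
  | 0 => a 0
  | k + 1 => if k + 1 ≤ l then a (k + 1) else op (a (k + 1)) (iterOp op a l k)

section IterOp

variable {N : Type*} {op : N → N → N} {a b : ℕ → N} {l k : ℕ}

theorem iterOp_self : iterOp op a l l = a l := by
  cases l <;> simp [iterOp]

theorem iterOp_succ (h : l ≤ k) : iterOp op a l (k + 1) = op (a (k + 1)) (iterOp op a l k) := by
  simp [iterOp, Nat.not_le.2 (Nat.lt_succ_of_le h)]

theorem iterOp_congr (hlk : l ≤ k) (h : ∀ i, l ≤ i → i ≤ k → a i = b i) :
    iterOp op a l k = iterOp op b l k := by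
  induction k, hlk using Nat.le_induction with
  | base => rw [iterOp_self, iterOp_self, h l le_rfl le_rfl]
  | succ k hk ih =>
    rw [iterOp_succ hk, iterOp_succ hk, h (k + 1) (by omega) le_rfl,
      ih fun i hi hik => h i hi (by omega)]

end IterOp

namespace StackMeasure

open HOStack

variable {N : Type*} [CommMonoid N] {op : N → N → N} {w : (γ : Γ) → DTree 𝒜 sharp φ γ → N}
  {μ : (k : ℕ) → AnnStack 𝒜 sharp φ k → N}

theorem cons_of_singleton (hμ : StackMeasure op w μ) {k : ℕ} {s : AnnStack 𝒜 sharp φ (k + 1)}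
    {t : AnnStack 𝒜 sharp φ k} (h : WellFormed (.cons s t)) (ht : (type t).card = 1) :
    μ (k + 1) (.cons s t) = op (μ (k + 1) s) (μ k t) := by
  obtain ⟨σ, hσ⟩ := Finset.card_eq_one.1 ht
  have hs := h.2.2.1
  rw [hσ, Finset.singleton_biUnion] at hs
  rw [hμ.cons, hσ, Finset.prod_singleton, ← hσ, restrict_eq_self h.2.1 subset_rfl,
    restrict_eq_self h.1 hs.subset]

theorem eq_prod (hμ : StackMeasure op w μ) {k : ℕ} {s : AnnStack 𝒜 sharp φ k}
    (h : WellFormed s) : μ k s = ∏ σ ∈ type s, μ k (HOPDA.restrict s {σ}) := by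
  cases s with
  | sym a =>
    simp only [HOPDA.restrict, hμ.sym, type, AnnSym.restrict, Finset.mem_singleton]
    exact (Finset.prod_fiberwise_of_maps_to (fun D hD => Finset.mem_image_of_mem _ hD) _).symm
  | nil k => simp [hμ.nil, type]
  | cons s t =>
    rw [hμ.cons, type, Finset.prod_image h.injOn]
    refine Finset.prod_congr rfl fun σ hσ => ?_
    rw [restrict_cons_singleton h hσ, cons_of_singleton hμ]
    · rw [← restrict_cons_singleton h hσ]
      exact h.restrict _
    · rw [type_restrict_of_subset (Finset.singleton_subset_iff.2 hσ), Finset.card_singleton]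

theorem restrict_eq_prod (hμ : StackMeasure op w μ) {k : ℕ} {s : AnnStack 𝒜 sharp φ k}
    (h : WellFormed s) {X : Finset (RunDesc Q M n k)} (hX : X ⊆ type s) :
    μ k (HOPDA.restrict s X) = ∏ σ ∈ X, μ k (HOPDA.restrict s {σ}) := by
  rw [hμ.eq_prod (h.restrict X), type_restrict_of_subset hX]
  refine Finset.prod_congr rfl fun σ hσ => ?_
  rw [restrict_restrict_of_subset _ (Finset.singleton_subset_iff.2 hσ)]

theorem comp_of_singleton (hμ : StackMeasure op w μ) {S : (i : ℕ) → AnnStack 𝒜 sharp φ i}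
    {l k : ℕ} (hlk : l ≤ k) (h : WellFormed (comp S l k)) (hl : (type (S l)).card = 1) :
    μ k (comp S l k) = iterOp op (fun i => μ i (S i)) l k := by
  induction k, hlk using Nat.le_induction with
  | base => rw [comp_self, iterOp_self]
  | succ k hlk ih =>
    rw [comp_succ _ hlk] at h ⊢
    rw [iterOp_succ hlk, hμ.cons_of_singleton h, ih h.2.1]
    rw [card_type_comp hlk h.2.1, hl]

theorem comp_eq_prod (hμ : StackMeasure op w μ) {S : (i : ℕ) → AnnStack 𝒜 sharp φ i}
    {k : ℕ} (hkn : k ≤ n) (h : WellFormed (comp S 0 k)) :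
    μ k (comp S 0 k) = ∏ ξ ∈ type (S 0), iterOp op
      (Function.update (fun i => μ i (HOPDA.restrict (S i) (pi2 (ξ.ass i)))) 0
        (μ 0 (HOPDA.restrict (S 0) {ξ}))) 0 k := by
  rw [hμ.eq_prod h, type_comp, Finset.prod_image (injOn_redIter h)]
  refine Finset.prod_congr rfl fun ξ hξ => ?_
  have hr := h.restrict {redIter ξ k}
  rw [restrict_comp hkn h hξ] at hr ⊢
  rw [hμ.comp_of_singleton (Nat.zero_le k) hr]
  · congr 1
    ext i
    cases i <;> simp
  · rw [Function.update_self, type_restrict_of_subset (Finset.singleton_subset_iff.2 hξ),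
      Finset.card_singleton]

theorem restrict_singleton_of_np (hμ : StackMeasure op w μ) (hop : op 1 1 = 1)
    (hw : ∀ γ (D : DTree 𝒜 sharp φ γ), D.1.flag = .np → w γ D = 1) {k : ℕ}
    {s : AnnStack 𝒜 sharp φ k} (h : WellFormed s) {σ : RunDesc Q M n k} (hσ : σ ∈ type s)
    (hf : σ.flag = .np) : μ k (HOPDA.restrict s {σ}) = 1 := by
  induction s with
  | sym a =>
    rw [HOPDA.restrict, hμ.sym]
    refine Finset.prod_eq_one fun D hD => hw _ _ ?_
    rw [Finset.mem_singleton.1 (Finset.mem_filter.1 hD).2, hf]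
  | nil k => simp [type] at hσ
  | @cons k s t ihs iht =>
    obtain ⟨ρ, hρ, rfl⟩ := Finset.mem_image.1 hσ
    rw [flag_red_succ] at hf
    have hsub : pi2 (ρ.ass (k + 1)) ⊆ type s := by
      rw [h.2.2.1]
      exact Finset.subset_biUnion_of_mem (fun σ => pi2 (σ.ass (k + 1))) hρ
    have hr := h.restrict {red (k + 1) ρ}
    rw [restrict_cons_singleton h hρ] at hr ⊢
    rw [hμ.cons_of_singleton hr, iht h.2.1 hρ hf.1, hμ.restrict_eq_prod h.1 hsub,
      Finset.prod_eq_one fun τ hτ => ihs h.1 (hsub hτ) (hf.2 τ hτ), hop]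
    rw [type_restrict_of_subset (Finset.singleton_subset_iff.2 hρ), Finset.card_singleton]

end StackMeasure

/-! ### The function `pow` of two arguments -/

/-- `pow(a, b) = (1 + a) ^ b - 1`. -/
def powTwo (a b : ℕ) : ℕ := (1 + a) ^ b - 1

theorem pow_pair (a b : ℕ) : pow [a, b] = powTwo a b := by
  simp [pow, powTwo]

theorem powTwo_add_one (a b : ℕ) : powTwo a b + 1 = (1 + a) ^ b :=
  Nat.sub_add_cancel (Nat.one_le_pow _ _ (by omega))

theorem powTwo_one_right (a : ℕ) : powTwo a 1 = a := by
  simp [powTwo]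

theorem powTwo_mono {a a' b b' : ℕ} (ha : a ≤ a') (hb : b ≤ b') : powTwo a b ≤ powTwo a' b' := by
  apply Nat.le_of_succ_le_succ
  rw [Nat.succ_eq_add_one, Nat.succ_eq_add_one, powTwo_add_one, powTwo_add_one]
  exact (Nat.pow_le_pow_left (by omega) b).trans (Nat.pow_le_pow_right (by omega) hb)

theorem powTwo_lt_right {a b b' : ℕ} (ha : 1 ≤ a) (hb : b < b') : powTwo a b < powTwo a b' := by
  apply Nat.lt_of_succ_lt_succ
  rw [Nat.succ_eq_add_one, Nat.succ_eq_add_one, powTwo_add_one, powTwo_add_one]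
  exact Nat.pow_lt_pow_right (by omega) hb

theorem one_le_powTwo {a b : ℕ} (ha : 1 ≤ a) (hb : 1 ≤ b) : 1 ≤ powTwo a b := by
  have := powTwo_mono ha hb
  rwa [powTwo_one_right] at this

theorem powTwo_powTwo (a b c : ℕ) : powTwo (powTwo a b) c = powTwo a (b * c) := by
  rw [powTwo, add_comm, powTwo_add_one, ← pow_mul, powTwo]

theorem powTwo_succ (a b : ℕ) : powTwo a (b + 1) = (1 + a) * powTwo a b + a := by
  have h1 := powTwo_add_one a (b + 1)
  have h2 := powTwo_add_one a b
  rw [pow_succ, ← h2] at h1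
  linarith

theorem powTwo_mul_le (a b c : ℕ) : powTwo a b * c ≤ powTwo (a * c) b := by
  rcases Nat.eq_zero_or_pos c with rfl | hc
  · simp
  induction b with
  | zero => simp [powTwo]
  | succ b ih =>
    rw [powTwo_succ, powTwo_succ]
    have : 1 + a ≤ 1 + a * c := Nat.add_le_add_left (Nat.le_mul_of_pos_right a hc) 1
    calc ((1 + a) * powTwo a b + a) * c = (1 + a) * (powTwo a b * c) + a * c := by ring
      _ ≤ _ := by gcongr

theorem powTwo_mul_powTwo_le (a b c d : ℕ) :
    powTwo a b * powTwo c d ≤ powTwo (a * c) (b * d) :=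
  calc powTwo a b * powTwo c d = powTwo c d * powTwo a b := mul_comm _ _
    _ ≤ powTwo (c * powTwo a b) d := powTwo_mul_le _ _ _
    _ ≤ powTwo (powTwo (a * c) b) d :=
      powTwo_mono (by rw [mul_comm]; exact powTwo_mul_le _ _ _) le_rfl
    _ = _ := powTwo_powTwo _ _ _

theorem mul_powTwo_le (c x y : ℕ) : c * powTwo x y ≤ powTwo x (c * y) := by
  rw [mul_comm c y, ← powTwo_powTwo]
  apply Nat.le_of_succ_le_succ
  rw [Nat.succ_eq_add_one, Nat.succ_eq_add_one, powTwo_add_one]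
  have key : ∀ z : ℕ, c * z + 1 ≤ (1 + z) ^ c := fun z => by
    induction c with
    | zero => simp
    | succ c ih => rw [pow_succ]; nlinarith [Nat.mul_le_mul_right (1 + z) ih, Nat.zero_le (c * z * z)]
  exact key _

theorem powTwo_pow_le {m : ℕ} (hm : 1 ≤ m) (x y : ℕ) : powTwo (x ^ m) y ≤ powTwo x (m * y) := by
  rw [← powTwo_powTwo]
  refine powTwo_mono ?_ le_rfl
  apply Nat.le_of_succ_le_succ
  rw [Nat.succ_eq_add_one, Nat.succ_eq_add_one, powTwo_add_one]
  have := pow_add_pow_le (zero_le_one' ℕ) (Nat.zero_le x) (by omega : m ≠ 0)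
  rw [one_pow] at this
  omega

/-! ### Iterated `pow` -/

section Iter

variable {a b : ℕ → ℕ} {l k m : ℕ}

theorem one_le_iterOp (h : ∀ i, i ≤ k → 1 ≤ a i) (hlk : l ≤ k) : 1 ≤ iterOp powTwo a l k := by
  induction k, hlk using Nat.le_induction with
  | base => rw [iterOp_self]; exact h l le_rfl
  | succ k hk ih =>
    rw [iterOp_succ hk]
    exact one_le_powTwo (h _ le_rfl) (ih fun i hi => h i (by omega))

theorem iterOp_extend_le {l' : ℕ} (hl : l ≤ k) (hl' : l' ≤ k) (hkm : k ≤ m)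
    (heq : ∀ i, k < i → i ≤ m → a i = b i)
    (h : iterOp powTwo a l k ≤ iterOp powTwo b l' k) :
    iterOp powTwo a l m ≤ iterOp powTwo b l' m := by
  induction m, hkm using Nat.le_induction with
  | base => exact h
  | succ m hm ih =>
    rw [iterOp_succ (by omega), iterOp_succ (by omega), heq _ (by omega) le_rfl]
    exact powTwo_mono le_rfl (ih fun i h1 h2 => heq i h1 (by omega))

theorem iterOp_extend_lt {l' : ℕ} (hl : l ≤ k) (hl' : l' ≤ k) (hkm : k ≤ m)
    (heq : ∀ i, k < i → i ≤ m → a i = b i) (hone : ∀ i, k < i → i ≤ m → 1 ≤ b i)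
    (h : iterOp powTwo a l k < iterOp powTwo b l' k) :
    iterOp powTwo a l m < iterOp powTwo b l' m := by
  induction m, hkm using Nat.le_induction with
  | base => exact h
  | succ m hm ih =>
    rw [iterOp_succ (by omega), iterOp_succ (by omega), heq _ (by omega) le_rfl]
    exact powTwo_lt_right (hone _ (by omega) le_rfl)
      (ih (fun i h1 h2 => heq i h1 (by omega)) fun i h1 h2 => hone i h1 (by omega))

theorem iterOp_mul_le : iterOp powTwo a 0 k * iterOp powTwo b 0 k ≤
    iterOp powTwo (fun i => a i * b i) 0 k := by
  induction k with
  | zero => exact le_rfl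
  | succ k ih =>
    simp only [iterOp_succ (Nat.zero_le k)]
    exact (powTwo_mul_powTwo_le _ _ _ _).trans (powTwo_mono le_rfl ih)

theorem prod_iterOp_le {ι : Type*} (X : Finset ι) (a : ι → ℕ → ℕ) :
    ∏ ξ ∈ X, iterOp powTwo (a ξ) 0 k ≤ iterOp powTwo (fun i => ∏ ξ ∈ X, a ξ i) 0 k := by
  induction X using Finset.induction_on with
  | empty =>
    simp only [Finset.prod_empty]
    exact one_le_iterOp (fun _ _ => le_rfl) (Nat.zero_le k)
  | insert ξ X hξ ih =>
    simp only [Finset.prod_insert hξ]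
    exact (Nat.mul_le_mul_left _ ih).trans iterOp_mul_le

/-- Merging the two upper levels of `b` after a push. -/
theorem powTwo_iterOp_le (a b : ℕ → ℕ) (j : ℕ) :
    powTwo (iterOp powTwo a 0 (j + 1)) (iterOp powTwo b 0 j) ≤
      powTwo (a (j + 1)) (iterOp powTwo (fun i => a i * b i) 0 j) := by
  rw [iterOp_succ (Nat.zero_le j), powTwo_powTwo]
  exact powTwo_mono le_rfl iterOp_mul_le

theorem mul_iterOp_le {y : ℕ} (hm : 1 ≤ m) (h : ∀ i, 0 < i → i ≤ k → a i ≤ b i ^ m)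
    (h0 : a 0 ≤ y) (c : ℕ) :
    c * iterOp powTwo a 0 k ≤ iterOp powTwo (Function.update b 0 (c * m ^ k * y)) 0 k := by
  induction k generalizing c with
  | zero => simpa [iterOp] using Nat.mul_le_mul_left c h0
  | succ k ih =>
    rw [iterOp_succ (Nat.zero_le k), iterOp_succ (Nat.zero_le k),
      Function.update_of_ne (by omega)]
    calc c * powTwo (a (k + 1)) (iterOp powTwo a 0 k)
        ≤ c * powTwo (b (k + 1) ^ m) (iterOp powTwo a 0 k) :=
          Nat.mul_le_mul_left _ (powTwo_mono (h _ (by omega) le_rfl) le_rfl)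
      _ ≤ c * powTwo (b (k + 1)) (m * iterOp powTwo a 0 k) :=
          Nat.mul_le_mul_left _ (powTwo_pow_le hm _ _)
      _ ≤ powTwo (b (k + 1)) (c * m * iterOp powTwo a 0 k) := by
          rw [mul_assoc]; exact mul_powTwo_le _ _ _
      _ ≤ _ := by
          refine powTwo_mono le_rfl ((ih (fun i h1 h2 => h i h1 (by omega)) (c * m)).trans_eq ?_)
          rw [pow_succ']
          congr 2
          ring

theorem iterOp_lt_iterOp_zero (hlt : a 0 < b 0) (h : ∀ i, 0 < i → i ≤ k → a i = b i)
    (hone : ∀ i, 0 < i → i ≤ k → 1 ≤ b i) : iterOp powTwo a 0 k < iterOp powTwo b 0 k :=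
  iterOp_extend_lt le_rfl le_rfl (Nat.zero_le k) h hone hlt

/-- The numerical estimate behind a push operation of order `j + 1`. -/
theorem iterOp_push_lt {n t j c : ℕ} (ht : 1 ≤ t) (hj : j + 1 ≤ n) (hc : 1 ≤ c)
    (hb : ∀ i, 0 < i → i ≤ j + 1 → 1 ≤ b i)
    (h : ∀ i, 0 < i → i ≤ j → a i ≤ b i ^ (t + 1)) (htop : a (j + 1) ≤ b (j + 1) ^ t)
    (h0 : a 0 ≤ c) (hb0 : b 0 = (2 * t) ^ n * c) :
    iterOp powTwo a 0 (j + 1) < iterOp powTwo b 0 (j + 1) := by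
  have hfac : t * (t + 1) ^ j < (2 * t) ^ n :=
    calc t * (t + 1) ^ j < 2 * t * (t + 1) ^ j :=
          Nat.mul_lt_mul_of_pos_right (by omega) (by positivity)
      _ ≤ 2 * t * (2 * t) ^ j := Nat.mul_le_mul_left _ (Nat.pow_le_pow_left (by omega) _)
      _ = (2 * t) ^ (j + 1) := (pow_succ' _ _).symm
      _ ≤ _ := Nat.pow_le_pow_right (by omega) hj
  rw [iterOp_succ (Nat.zero_le j), iterOp_succ (Nat.zero_le j)]
  calc powTwo (a (j + 1)) (iterOp powTwo a 0 j)
      ≤ powTwo (b (j + 1) ^ t) (iterOp powTwo a 0 j) := powTwo_mono htop le_rfl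
    _ ≤ powTwo (b (j + 1)) (t * iterOp powTwo a 0 j) := powTwo_pow_le ht _ _
    _ ≤ powTwo (b (j + 1)) (iterOp powTwo (Function.update b 0 (t * (t + 1) ^ j * c)) 0 j) :=
        powTwo_mono le_rfl (mul_iterOp_le (by omega) h h0 t)
    _ < _ := by
        refine powTwo_lt_right (hb _ (by omega) le_rfl) (iterOp_lt_iterOp_zero ?_ ?_ ?_)
        · rw [Function.update_self, hb0]
          exact Nat.mul_lt_mul_of_pos_right hfac hc
        · exact fun i hi _ => Function.update_of_ne (by omega) _ _
        · exact fun i h1 h2 => hb i h1 (by omega)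

end Iter

/-! ### The constants `C_z` -/

theorem two_le_constC {n t : ℕ} (ht : 1 ≤ t) (z : ℕ) : 2 ≤ constC n t z := by
  induction z with
  | zero => exact le_rfl
  | succ z ih =>
    calc 2 ≤ constC n t z := ih
      _ ≤ constC n t z ^ (t + 1) := Nat.le_self_pow (by omega) _
      _ ≤ _ := Nat.le_mul_of_pos_left _ (by positivity)

theorem constC_lt_succ {n t : ℕ} (ht : 1 ≤ t) (z : ℕ) : constC n t z < constC n t (z + 1) := by
  have h2 := two_le_constC (n := n) ht z
  calc constC n t z = constC n t z ^ 1 := (pow_one _).symm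
    _ < constC n t z ^ (t + 1) := Nat.pow_lt_pow_right (by omega) (by omega)
    _ ≤ _ := Nat.le_mul_of_pos_left _ (by positivity)

theorem constC_mono {n t : ℕ} (ht : 1 ≤ t) : Monotone (constC n t) :=
  monotone_nat_of_le_succ fun z => (constC_lt_succ ht z).le

/-! ### Products over overlapping sets -/

@[to_additive]
theorem prod_mul_prod_prod_eq {ι κ N : Type*} [CommMonoid N] (U B : Finset ι) (X : Finset κ)
    (F : κ → Finset ι) (hU : U = B ∪ X.biUnion F) (v : ι → N) :
    (∏ ξ ∈ X, ∏ ρ ∈ F ξ, v ρ) * ∏ ρ ∈ B, v ρ =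
      ∏ ρ ∈ U, v ρ ^ ((X.filter fun ξ => ρ ∈ F ξ).card + if ρ ∈ B then 1 else 0) := by
  have hB : B ⊆ U := hU ▸ Finset.subset_union_left
  have hF : ∀ ξ ∈ X, F ξ ⊆ U := fun ξ hξ =>
    (Finset.subset_biUnion_of_mem F hξ).trans (hU ▸ Finset.subset_union_right)
  have key : ∀ Y ⊆ U, ∏ ρ ∈ Y, v ρ = ∏ ρ ∈ U, v ρ ^ (if ρ ∈ Y then 1 else 0) := by
    intro Y hY
    rw [← Finset.prod_subset hY]
    · exact Finset.prod_congr rfl fun ρ hρ => by simp [hρ]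
    · exact fun ρ _ hρ => by simp [hρ]
  rw [key B hB, Finset.prod_congr rfl fun ξ hξ => key (F ξ) (hF ξ hξ), Finset.prod_comm,
    ← Finset.prod_mul_distrib]
  refine Finset.prod_congr rfl fun ρ _ => ?_
  rw [pow_add, Finset.prod_pow_eq_pow_sum, Finset.card_filter]

section Overlap

variable {ι κ : Type*} {U B : Finset ι} {X : Finset κ} {F : κ → Finset ι}

theorem prod_overlap_le {t : ℕ} (hU : U = B ∪ X.biUnion F) {v : ι → ℕ} (hv : ∀ ρ ∈ U, 1 ≤ v ρ)
    (hX : X.card + (if B = ∅ then 0 else 1) ≤ t) :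
    (∏ ξ ∈ X, ∏ ρ ∈ F ξ, v ρ) * ∏ ρ ∈ B, v ρ ≤ (∏ ρ ∈ U, v ρ) ^ t := by
  rw [prod_mul_prod_prod_eq U B X F hU, ← Finset.prod_pow]
  refine Finset.prod_le_prod' fun ρ hρ => Nat.pow_le_pow_right (hv ρ hρ) (le_trans ?_ hX)
  refine Nat.add_le_add (Finset.card_filter_le _ _) ?_
  split_ifs with h1 h2 <;> simp_all

theorem prod_overlap_eq {N : Type*} [CommMonoid N] (hU : U = B ∪ X.biUnion F) {v : ι → N}
    (h1 : ∀ ξ ∈ X, ∀ η ∈ X, ξ ≠ η → ∀ ρ ∈ F ξ ∩ F η, v ρ = 1)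
    (h2 : ∀ ρ ∈ B ∩ X.biUnion F, v ρ = 1) :
    (∏ ξ ∈ X, ∏ ρ ∈ F ξ, v ρ) * ∏ ρ ∈ B, v ρ = ∏ ρ ∈ U, v ρ := by
  rw [prod_mul_prod_prod_eq U B X F hU]
  refine Finset.prod_congr rfl fun ρ hρ => ?_
  by_cases hv : v ρ = 1
  · rw [hv, one_pow]
  have hle : (X.filter fun ξ => ρ ∈ F ξ).card ≤ 1 := Finset.card_le_one.2 fun ξ hξ η hη => by
    rw [Finset.mem_filter] at hξ hη
    by_contra hne
    exact hv (h1 ξ hξ.1 η hη.1 hne ρ (Finset.mem_inter.2 ⟨hξ.2, hη.2⟩))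
  have hpos : ρ ∈ X.biUnion F ↔ 0 < (X.filter fun ξ => ρ ∈ F ξ).card := by
    simp [Finset.card_pos, Finset.Nonempty]
  have hone : (X.filter fun ξ => ρ ∈ F ξ).card + (if ρ ∈ B then 1 else 0) = 1 := by
    rw [hU, Finset.mem_union, hpos] at hρ
    by_cases hB : ρ ∈ B
    · have : ¬ 0 < (X.filter fun ξ => ρ ∈ F ξ).card := fun h =>
        hv (h2 ρ (Finset.mem_inter.2 ⟨hB, hpos.2 h⟩))
      simp only [hB, if_true]
      omega
    · simp only [hB, if_false, false_or] at hρ ⊢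
      omega
  rw [hone, pow_one]

theorem sum_overlap_le (hU : U = B ∪ X.biUnion F) (v : ι → ℕ) :
    ∑ ρ ∈ U, v ρ ≤ (∑ ξ ∈ X, ∑ ρ ∈ F ξ, v ρ) + ∑ ρ ∈ B, v ρ := by
  rw [sum_add_sum_sum_eq U B X F hU]
  refine Finset.sum_le_sum fun ρ hρ => ?_
  rw [smul_eq_mul]
  refine Nat.le_mul_of_pos_left _ ?_
  rw [hU, Finset.mem_union, Finset.mem_biUnion] at hρ
  rcases hρ with hρ | ⟨ξ, hξ, hρ⟩
  · simp [hρ]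
  · have : 0 < (X.filter fun ξ => ρ ∈ F ξ).card :=
      Finset.card_pos.2 ⟨ξ, Finset.mem_filter.2 ⟨hξ, hρ⟩⟩
    omega

theorem sum_overlap_lt_of_mem_of_mem (hU : U = B ∪ X.biUnion F) {v : ι → ℕ} {ξ η : κ}
    (hξ : ξ ∈ X) (hη : η ∈ X) (hne : ξ ≠ η) {ρ : ι} (h1 : ρ ∈ F ξ) (h2 : ρ ∈ F η)
    (hv : 1 ≤ v ρ) : ∑ ρ ∈ U, v ρ < (∑ ξ ∈ X, ∑ ρ ∈ F ξ, v ρ) + ∑ ρ ∈ B, v ρ := by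
  have hU' : U = B ∪ (X.erase ξ).biUnion F ∪ F ξ := by
    rw [hU, Finset.union_assoc, Finset.union_comm _ (F ξ), ← Finset.biUnion_insert,
      Finset.insert_erase hξ]
  have h := sum_overlap_le (B := B) (X := X.erase ξ) (F := F) rfl v
  have h3 := Finset.sum_union_inter (f := v) (s₁ := B ∪ (X.erase ξ).biUnion F) (s₂ := F ξ)
  have h4 : v ρ ≤ ∑ x ∈ (B ∪ (X.erase ξ).biUnion F) ∩ F ξ, v x :=
    Finset.single_le_sum (fun _ _ => Nat.zero_le _) (Finset.mem_inter.2
      ⟨Finset.mem_union_right _ (Finset.mem_biUnion.2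
        ⟨η, Finset.mem_erase.2 ⟨hne.symm, hη⟩, h2⟩), h1⟩)
  rw [← hU'] at h3
  rw [← Finset.add_sum_erase X _ hξ]
  omega

theorem sum_overlap_lt_of_mem_inter (hU : U = B ∪ X.biUnion F) {v : ι → ℕ} {ρ : ι}
    (h : ρ ∈ B ∩ X.biUnion F) (hv : 1 ≤ v ρ) :
    ∑ ρ ∈ U, v ρ < (∑ ξ ∈ X, ∑ ρ ∈ F ξ, v ρ) + ∑ ρ ∈ B, v ρ := by
  have h1 := sum_overlap_le (B := ∅) (X := X) (F := F) (Finset.empty_union _).symm v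
  have h3 := Finset.sum_union_inter (f := v) (s₁ := B) (s₂ := X.biUnion F)
  have h4 : v ρ ≤ ∑ x ∈ B ∩ X.biUnion F, v x :=
    Finset.single_le_sum (fun _ _ => Nat.zero_le _) h
  rw [Finset.sum_empty] at h1
  rw [hU]
  omega

end Overlap

open HOStack

theorem sum_Icc_extend_le {f g : ℕ → ℕ} {e l l' k m : ℕ} (hl : l ≤ k) (hl' : l' ≤ k) (hkm : k ≤ m)
    (heq : ∀ i, k < i → i ≤ m → f i = g i)
    (h : ∑ i ∈ Finset.Icc l k, f i ≤ e + ∑ i ∈ Finset.Icc l' k, g i) :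
    ∑ i ∈ Finset.Icc l m, f i ≤ e + ∑ i ∈ Finset.Icc l' m, g i := by
  induction m, hkm using Nat.le_induction with
  | base => exact h
  | succ m hm ih =>
    rw [Finset.sum_Icc_succ_top (by omega), Finset.sum_Icc_succ_top (by omega),
      heq _ (by omega) le_rfl]
    have := ih fun i h1 h2 => heq i h1 (by omega)
    omega

theorem mul_le_powTwo (x y : ℕ) : y * x ≤ powTwo x y := by
  simpa [powTwo_one_right] using mul_powTwo_le y x 1

theorem le_iterOp_zero {a : ℕ → ℕ} {k : ℕ} (h : ∀ i, i ≤ k → 1 ≤ a i) :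
    a 0 ≤ iterOp powTwo a 0 k := by
  induction k with
  | zero => exact le_rfl
  | succ k ih =>
    rw [iterOp_succ (Nat.zero_le k)]
    calc a 0 ≤ iterOp powTwo a 0 k := ih fun i hi => h i (by omega)
      _ ≤ iterOp powTwo a 0 k * a (k + 1) := Nat.le_mul_of_pos_right _ (h _ le_rfl)
      _ ≤ _ := mul_le_powTwo _ _

/-! ### `low`, `high` and `len` as measures -/

theorem prodMeasure_isStackMeasure (f : (γ : Γ) → DTree 𝒜 sharp φ γ → ℕ)
    (base : AnnSym 𝒜 sharp φ → ℕ) (hbase : ∀ a, base a = ∏ D ∈ a.trees, f a.sym D) :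
    StackMeasure powTwo f (fun _ s => prodMeasure base s) where
  sym a := by rw [prodMeasure, hbase]
  nil k := by rw [prodMeasure]
  cons s t := by simp only [prodMeasure, pow_pair]

theorem high_isStackMeasure : StackMeasure powTwo
    (fun _ (D : DTree 𝒜 sharp φ _) => if D.1.flag = .pr then D.weight else 1)
    (fun _ s => high s) :=
  prodMeasure_isStackMeasure _ _ fun _ => Finset.prod_filter _ _

theorem len_isStackMeasure : StackMeasure powTwo
    (fun _ (D : DTree 𝒜 sharp φ _) => D.weight) (fun _ s => len s) :=
  prodMeasure_isStackMeasure _ _ fun _ => rfl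

theorem low_isStackMeasure : StackMeasure (· * ·)
    (fun _ (D : DTree 𝒜 sharp φ _) => Multiplicative.ofAdd (if D.1.flag = .pr then 1 else 0))
    (fun _ s => Multiplicative.ofAdd (low s)) where
  sym a := by
    rw [low, type, Finset.card_filter, Finset.sum_image fun D hD E hE h => a.inj D hD E hE h,
      ofAdd_sum]
  nil k := by rw [low, ofAdd_zero]
  cons s t := by simp only [low, ofAdd_sum, ofAdd_add]

theorem StackMeasure.one_le {f : (γ : Γ) → DTree 𝒜 sharp φ γ → ℕ}
    {μ : (k : ℕ) → AnnStack 𝒜 sharp φ k → ℕ} (hμ : StackMeasure powTwo f μ)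
    (hf : ∀ γ D, 1 ≤ f γ D) {k : ℕ} (s : AnnStack 𝒜 sharp φ k) : 1 ≤ μ k s := by
  induction h : s.nodes using Nat.strong_induction_on generalizing k s with
  | _ d ih =>
    cases s with
    | sym a => rw [hμ.sym]; exact Finset.one_le_prod' fun D _ => hf _ D
    | nil k => rw [hμ.nil]
    | cons s t =>
      rw [hμ.cons]
      simp only [HOStack.nodes] at h
      exact Finset.one_le_prod' fun σ _ => one_le_powTwo
        (ih _ (by omega) _ (nodes_restrict s _)) (ih _ (by omega) _ (nodes_restrict t _))

theorem low_eq_sum {k : ℕ} {s : AnnStack 𝒜 sharp φ k} (h : WellFormed s) :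
    low s = ∑ σ ∈ type s, low (restrict s {σ}) := by
  have := congrArg Multiplicative.toAdd (low_isStackMeasure.eq_prod h)
  simpa only [toAdd_ofAdd, toAdd_prod] using this

theorem low_restrict_eq_sum {k : ℕ} {s : AnnStack 𝒜 sharp φ k} (h : WellFormed s)
    {X : Finset (RunDesc Q M n k)} (hX : X ⊆ type s) :
    low (restrict s X) = ∑ σ ∈ X, low (restrict s {σ}) := by
  have := congrArg Multiplicative.toAdd (low_isStackMeasure.restrict_eq_prod h hX)
  simpa only [toAdd_ofAdd, toAdd_prod] using this

theorem toAdd_iterOp_mul (a : ℕ → Multiplicative ℕ) {l k : ℕ} (hlk : l ≤ k) :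
    (iterOp (· * ·) a l k).toAdd = ∑ i ∈ Finset.Icc l k, (a i).toAdd := by
  induction k, hlk using Nat.le_induction with
  | base => simp [iterOp_self]
  | succ k hk ih =>
    rw [iterOp_succ hk, Finset.sum_Icc_succ_top (by omega), toAdd_mul, ih, add_comm]

theorem low_comp {S : (i : ℕ) → AnnStack 𝒜 sharp φ i} {l k : ℕ} (hlk : l ≤ k)
    (h : WellFormed (comp S l k)) (hl : (type (S l)).card = 1) :
    low (comp S l k) = ∑ i ∈ Finset.Icc l k, low (S i) := by
  have := congrArg Multiplicative.toAdd (low_isStackMeasure.comp_of_singleton hlk h hl)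
  simpa only [toAdd_ofAdd, toAdd_iterOp_mul _ hlk] using this

theorem low_comp_eq_sum {S : (i : ℕ) → AnnStack 𝒜 sharp φ i} {k : ℕ} (hkn : k ≤ n)
    (h : WellFormed (comp S 0 k)) : low (comp S 0 k) =
      ∑ ξ ∈ type (S 0), ∑ i ∈ Finset.Icc 0 k,
        (if i = 0 then low (restrict (S 0) {ξ}) else low (restrict (S i) (pi2 (ξ.ass i)))) := by
  have := congrArg Multiplicative.toAdd (low_isStackMeasure.comp_eq_prod hkn h)
  simp only [toAdd_ofAdd, toAdd_prod, toAdd_iterOp_mul _ (Nat.zero_le k)] at this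
  rw [this]
  refine Finset.sum_congr rfl fun ξ _ => Finset.sum_congr rfl fun i _ => ?_
  cases i <;> simp

theorem one_le_low_restrict_singleton {k : ℕ} {s : AnnStack 𝒜 sharp φ k} (h : WellFormed s)
    {σ : RunDesc Q M n k} (hσ : σ ∈ type s) (hf : σ.flag = .pr) : 1 ≤ low (restrict s {σ}) := by
  induction s with
  | sym a =>
    rw [restrict, low]
    refine Finset.card_pos.2 ⟨σ, Finset.mem_filter.2 ⟨?_, hf⟩⟩
    have := type_restrict_of_subset (Finset.singleton_subset_iff.2 hσ)
    rw [restrict] at this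
    rw [this]
    exact Finset.mem_singleton_self _
  | nil k => simp [type] at hσ
  | @cons k s t ihs iht =>
    obtain ⟨ρ, hρ, rfl⟩ := Finset.mem_image.1 hσ
    have hsub : pi2 (ρ.ass (k + 1)) ⊆ type s := by
      rw [h.2.2.1]
      exact Finset.subset_biUnion_of_mem (fun σ => pi2 (σ.ass (k + 1))) hρ
    have hr := h.restrict {red (k + 1) ρ}
    rw [restrict_cons_singleton h hρ] at hr ⊢
    have hc := congrArg Multiplicative.toAdd (low_isStackMeasure.cons_of_singleton hr (by
      rw [type_restrict_of_subset (Finset.singleton_subset_iff.2 hρ), Finset.card_singleton]))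
    simp only [toAdd_ofAdd, toAdd_mul] at hc
    rw [hc]
    by_cases hρf : ρ.flag = .pr
    · exact (iht h.2.1 hρ hρf).trans (Nat.le_add_left _ _)
    · have hnot : ¬ AllNp (pi2 (ρ.ass (k + 1))) := fun hall => by
        rw [(flag_red_succ ρ).2 ⟨not_not.1 (mt Flag.ne_np.1 hρf), hall⟩] at hf
        cases hf
      unfold AllNp at hnot
      push Not at hnot
      obtain ⟨τ, hτ, hτf⟩ := hnot
      rw [low_restrict_eq_sum h.1 hsub]
      refine le_trans ?_ (Nat.le_add_right _ _)
      exact (ihs h.1 (hsub hτ) (Flag.ne_np.1 hτf)).trans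
        (Finset.single_le_sum (f := fun σ => low (restrict s {σ})) (fun _ _ => Nat.zero_le _) hτ)

theorem two_le_weight [Finite Q] [Finite M] {γ : Γ} (D : DTree 𝒜 sharp φ γ) : 2 ≤ D.weight :=
  have : Nonempty (RunDesc Q M n 0) := ⟨D.1⟩
  two_le_constC Nat.card_pos _

theorem type_single {γ : Γ} {σ : RunDesc Q M n 0} (D : Deriv 𝒜 sharp φ γ σ) :
    type (.sym (.single D) : AnnStack 𝒜 sharp φ 0) = {σ} := by
  simp [type, AnnSym.single]

theorem type_ofFun (γ : Γ) (X : Finset (RunDesc Q M n 0))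
    (E : (σ : RunDesc Q M n 0) → σ ∈ X → Deriv 𝒜 sharp φ γ σ) :
    type (.sym (.ofFun γ X E) : AnnStack 𝒜 sharp φ 0) = X := by
  simp [type, AnnSym.ofFun, Finset.image_image, Function.comp_def]

theorem StackMeasure.single {N : Type*} [CommMonoid N] {op : N → N → N}
    {f : (γ : Γ) → DTree 𝒜 sharp φ γ → N} {μ : (k : ℕ) → AnnStack 𝒜 sharp φ k → N}
    (hμ : StackMeasure op f μ) {γ : Γ} {σ : RunDesc Q M n 0} (D : Deriv 𝒜 sharp φ γ σ) :
    μ 0 (.sym (.single D)) = f γ ⟨σ, D⟩ := by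
  rw [hμ.sym]
  exact Finset.prod_singleton _ _

theorem low_single {γ : Γ} {σ : RunDesc Q M n 0} (D : Deriv 𝒜 sharp φ γ σ) :
    low (.sym (.single D) : AnnStack 𝒜 sharp φ 0) = if σ.flag = .pr then 1 else 0 := by
  have := congrArg Multiplicative.toAdd (low_isStackMeasure.single D)
  simpa only [toAdd_ofAdd] using this

theorem high_single {γ : Γ} {σ : RunDesc Q M n 0} (D : Deriv 𝒜 sharp φ γ σ) :
    high (.sym (.single D) : AnnStack 𝒜 sharp φ 0) =
      if σ.flag = .pr then DTree.weight (⟨σ, D⟩ : DTree 𝒜 sharp φ γ) else 1 :=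
  high_isStackMeasure.single D

theorem len_single {γ : Γ} {σ : RunDesc Q M n 0} (D : Deriv 𝒜 sharp φ γ σ) :
    len (.sym (.single D) : AnnStack 𝒜 sharp φ 0) =
      DTree.weight (⟨σ, D⟩ : DTree 𝒜 sharp φ γ) :=
  len_isStackMeasure.single D

theorem one_le_high [Finite Q] [Finite M] {k : ℕ} (s : AnnStack 𝒜 sharp φ k) : 1 ≤ high s :=
  high_isStackMeasure.one_le (fun _ D => by
    split_ifs
    · exact one_le_two.trans (two_le_weight D)
    · exact le_rfl) s

theorem one_le_len [Finite Q] [Finite M] {k : ℕ} (s : AnnStack 𝒜 sharp φ k) : 1 ≤ len s :=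
  len_isStackMeasure.one_le (fun _ D => one_le_two.trans (two_le_weight D)) s

theorem wellFormed_sym (a : AnnSym 𝒜 sharp φ) : WellFormed (.sym a : AnnStack 𝒜 sharp φ 0) :=
  trivial

theorem card_type_single {γ : Γ} {σ : RunDesc Q M n 0} (D : Deriv 𝒜 sharp φ γ σ) :
    (type (.sym (.single D) : AnnStack 𝒜 sharp φ 0)).card = 1 := by
  rw [type_single, Finset.card_singleton]

theorem high_comp {S : (i : ℕ) → AnnStack 𝒜 sharp φ i} {l k : ℕ} (hlk : l ≤ k)
    (h : WellFormed (comp S l k)) (hl : (type (S l)).card = 1) :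
    high (comp S l k) = iterOp powTwo (fun i => high (S i)) l k :=
  high_isStackMeasure.comp_of_singleton hlk h hl

theorem len_comp {S : (i : ℕ) → AnnStack 𝒜 sharp φ i} {l k : ℕ} (hlk : l ≤ k)
    (h : WellFormed (comp S l k)) (hl : (type (S l)).card = 1) :
    len (comp S l k) = iterOp powTwo (fun i => len (S i)) l k :=
  len_isStackMeasure.comp_of_singleton hlk h hl

theorem type_eq_pi2_ass {S : (i : ℕ) → AnnStack 𝒜 sharp φ i} (h : WellFormed (comp S 0 n))
    {γ : Γ} {σ : RunDesc Q M n 0} {D : Deriv 𝒜 sharp φ γ σ} (hS : S 0 = .sym (.single D)) {i : ℕ}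
    (hi : 0 < i) (hin : i ≤ n) : type (S i) = pi2 (σ.ass i) := by
  rw [type_eq_of_comp le_rfl h hi hin, hS, type_single, Finset.singleton_biUnion]

/-! ### Reading steps -/

section Read

variable {S : (i : ℕ) → AnnStack 𝒜 sharp φ i} {γ : Γ} {p : Q} {r : A ↪ Q}
  {hδ : 𝒜.δ γ p = .read r} {a : A} {τ : RunDesc Q M n 0} {hτ : τ.state = r a}
  {D' : Deriv 𝒜 sharp φ γ τ}

theorem low_read_le (hS : S 0 = .sym (.single (Deriv.read γ p r hδ a τ hτ D')))
    (h : WellFormed (comp S 0 n))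
    (h' : WellFormed (comp (Function.update S 0 (.sym (.single D'))) 0 n)) :
    low (comp S 0 n) ≤ (if a = sharp then 1 else 0) +
      low (comp (Function.update S 0 (.sym (.single D'))) 0 n) := by
  rw [low_comp (Nat.zero_le n) h (by rw [hS, card_type_single]),
    low_comp (Nat.zero_le n) h' (by rw [Function.update_self, card_type_single])]
  refine sum_Icc_extend_le le_rfl le_rfl (Nat.zero_le n)
    (fun i hi _ => by rw [Function.update_of_ne (by omega)]) ?_
  rw [Finset.Icc_self, Finset.sum_singleton, Finset.sum_singleton, hS, Function.update_self,
    low_single, low_single, flag_mk]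
  by_cases h1 : a = sharp <;> cases h2 : τ.flag <;> simp [h1]

variable [Finite Q] [Finite M]

theorem weight_read_lt : DTree.weight (⟨_, D'⟩ : DTree 𝒜 sharp φ γ) <
    DTree.weight (⟨_, Deriv.read γ p r hδ a τ hτ D'⟩ : DTree 𝒜 sharp φ γ) := by
  have : Nonempty (RunDesc Q M n 0) := ⟨τ⟩
  rw [DTree.weight, DTree.weight, Deriv.depth, add_comm]
  exact constC_lt_succ Nat.card_pos _

theorem high_read_ge (hS : S 0 = .sym (.single (Deriv.read γ p r hδ a τ hτ D')))
    (h : WellFormed (comp S 0 n))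
    (h' : WellFormed (comp (Function.update S 0 (.sym (.single D'))) 0 n)) :
    (if a = sharp then 1 else 0) + high (comp (Function.update S 0 (.sym (.single D'))) 0 n) ≤
      high (comp S 0 n) := by
  have hw := weight_read_lt (hδ := hδ) (hτ := hτ) (D' := D')
  have hw2 := two_le_weight (⟨_, D'⟩ : DTree 𝒜 sharp φ γ)
  rw [high_comp (Nat.zero_le n) h (by rw [hS, card_type_single]),
    high_comp (Nat.zero_le n) h' (by rw [Function.update_self, card_type_single])]
  have heq : ∀ i, 0 < i → i ≤ n →
      high (Function.update S 0 (.sym (.single D')) i) = high (S i) :=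
    fun i hi _ => by rw [Function.update_of_ne (by omega)]
  by_cases hnp : τ.flag = .np ∧ a ≠ sharp
  · rw [if_neg hnp.2, zero_add]
    refine iterOp_extend_le le_rfl le_rfl (Nat.zero_le n) heq ?_
    rw [iterOp_self, iterOp_self, hS, Function.update_self, high_single, high_single, flag_mk]
    simp [hnp]
  · have : iterOp powTwo (fun i => high (Function.update S 0 (.sym (.single D')) i)) 0 n <
        iterOp powTwo (fun i => high (S i)) 0 n := by
      refine iterOp_extend_lt le_rfl le_rfl (Nat.zero_le n) heq (fun i _ _ => one_le_high _) ?_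
      rw [iterOp_self, iterOp_self, hS, Function.update_self, high_single, high_single, flag_mk]
      simp only [hnp, if_false, if_true]
      split_ifs <;> omega
    split_ifs <;> omega

theorem len_read_lt (hS : S 0 = .sym (.single (Deriv.read γ p r hδ a τ hτ D')))
    (h : WellFormed (comp S 0 n))
    (h' : WellFormed (comp (Function.update S 0 (.sym (.single D'))) 0 n)) :
    len (comp (Function.update S 0 (.sym (.single D'))) 0 n) < len (comp S 0 n) := by
  rw [len_comp (Nat.zero_le n) h (by rw [hS, card_type_single]),
    len_comp (Nat.zero_le n) h' (by rw [Function.update_self, card_type_single])]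
  refine iterOp_extend_lt le_rfl le_rfl (Nat.zero_le n)
    (fun i hi _ => by rw [Function.update_of_ne (by omega)]) (fun i _ _ => one_le_len _) ?_
  rw [iterOp_self, iterOp_self, hS, Function.update_self, len_single, len_single]
  exact weight_read_lt

end Read

/-! ### Pop steps -/

section Pop

variable {S : (i : ℕ) → AnnStack 𝒜 sharp φ i} {γ : Γ} {p q : Q} {k : ℕ}
  {hk : 1 ≤ k} {hn : k ≤ n} {hδ : 𝒜.δ γ p = .op q (.pop k hk hn)} {τ : RunDesc Q M n k}
  {hτ : τ.state = q}

theorem type_pop (hS : S 0 = .sym (.single (Deriv.pop γ p q k hk hn hδ τ hτ)))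
    (h : WellFormed (comp S 0 n)) {i : ℕ} (hi : 0 < i) (hik : i < k) : type (S i) = ∅ := by
  rw [type_eq_pi2_ass h hS hi (by omega), ass_mk _ _ _ hi (by omega),
    Function.update_of_ne (by omega), ass, dif_neg (by omega)]
  rfl

theorem type_pop_self (hS : S 0 = .sym (.single (Deriv.pop γ p q k hk hn hδ τ hτ)))
    (h : WellFormed (comp S 0 n)) : type (S k) = {τ} := by
  rw [type_eq_pi2_ass h hS (by omega) hn, ass_mk _ _ _ (by omega) hn, Function.update_self]
  simp [pi2]

theorem low_pop_le (hS : S 0 = .sym (.single (Deriv.pop γ p q k hk hn hδ τ hτ)))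
    (h : WellFormed (comp S 0 n)) (h' : WellFormed (comp S k n)) :
    low (comp S 0 n) ≤ low (comp S k n) := by
  rw [low_comp (Nat.zero_le n) h (by rw [hS, card_type_single]),
    low_comp hn h' (by rw [type_pop_self hS h, Finset.card_singleton])]
  have := sum_Icc_extend_le (f := fun i => low (S i)) (g := fun i => low (S i)) (e := 0)
    (Nat.zero_le k) le_rfl hn (fun _ _ _ => rfl) ?_
  · rwa [zero_add] at this
  rw [zero_add, Finset.Icc_self, Finset.sum_singleton]
  refine (Finset.sum_eq_single k (fun i hi hne => ?_) (by simp)).le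
  rw [Finset.mem_Icc] at hi
  rcases Nat.eq_zero_or_pos i with rfl | h0
  · rw [hS, low_single, flag_mk]
    simp
  · rw [low_eq_sum (h.of_comp (Nat.zero_le n) (Nat.zero_le i) (by omega)),
      type_pop hS h h0 (by omega), Finset.sum_empty]

variable [Finite Q] [Finite M]

theorem high_pop_ge (hS : S 0 = .sym (.single (Deriv.pop γ p q k hk hn hδ τ hτ)))
    (h : WellFormed (comp S 0 n)) (h' : WellFormed (comp S k n)) :
    high (comp S k n) ≤ high (comp S 0 n) := by
  rw [high_comp (Nat.zero_le n) h (by rw [hS, card_type_single]),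
    high_comp hn h' (by rw [type_pop_self hS h, Finset.card_singleton])]
  refine iterOp_extend_le le_rfl (Nat.zero_le k) hn (fun _ _ _ => rfl) ?_
  obtain ⟨j, rfl⟩ := Nat.exists_eq_add_of_le' hk
  rw [iterOp_self, iterOp_succ (Nat.zero_le j)]
  conv_lhs => rw [← powTwo_one_right (high _)]
  exact powTwo_mono le_rfl (one_le_iterOp (fun i _ => one_le_high _) (Nat.zero_le j))

theorem len_pop_lt (hS : S 0 = .sym (.single (Deriv.pop γ p q k hk hn hδ τ hτ)))
    (h : WellFormed (comp S 0 n)) (h' : WellFormed (comp S k n)) :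
    len (comp S k n) < len (comp S 0 n) := by
  rw [len_comp (Nat.zero_le n) h (by rw [hS, card_type_single]),
    len_comp hn h' (by rw [type_pop_self hS h, Finset.card_singleton])]
  refine iterOp_extend_lt le_rfl (Nat.zero_le k) hn (fun _ _ _ => rfl)
    (fun i _ _ => one_le_len _) ?_
  obtain ⟨j, rfl⟩ := Nat.exists_eq_add_of_le' hk
  rw [iterOp_self, iterOp_succ (Nat.zero_le j)]
  conv_lhs => rw [← powTwo_one_right (len _)]
  refine powTwo_lt_right (one_le_len _) ?_
  have h1 := le_iterOp_zero (a := fun i => len (S i)) (k := j) fun i _ => one_le_len _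
  have h2 := two_le_weight
    (⟨_, Deriv.pop γ p q (j + 1) hk hn hδ τ hτ⟩ : DTree 𝒜 sharp φ γ)
  simp only [hS, len_single] at h1
  omega

end Pop

/-! ### Push steps -/

section Push

/-- The `k`-stack below the new top after a push of order `k`. -/
noncomputable def pushedStack (S : (i : ℕ) → AnnStack 𝒜 sharp φ i)
    (Φ : (i : ℕ) → Finset (M × RunDesc Q M n i)) (γ : Γ)
    (E : (σ : RunDesc Q M n 0) → σ ∈ pi2 (Φ 0) → Deriv 𝒜 sharp φ γ σ) (k : ℕ) :
    AnnStack 𝒜 sharp φ k :=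
  comp (Function.update (fun i => restrict (S i) (pi2 (Φ i))) 0
    (.sym (.ofFun γ (pi2 (Φ 0)) E))) 0 k

/-- The components of the stack after a push of order `k`. -/
noncomputable def pushStack (S : (i : ℕ) → AnnStack 𝒜 sharp φ i) {α : Γ} {τ : RunDesc Q M n 0}
    (D' : Deriv 𝒜 sharp φ α τ) (k : ℕ) (T : AnnStack 𝒜 sharp φ k) :
    (i : ℕ) → AnnStack 𝒜 sharp φ i :=
  Function.update (Function.update
    (fun i => if i < k then restrict (S i) (pi2 (τ.ass i)) else S i) 0 (.sym (.single D'))) k T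

/-- The part of the type of the `i`-th component used by the tree for the pushed symbol. -/
noncomputable def upperAss (τ : RunDesc Q M n 0) (k i : ℕ) : Finset (RunDesc Q M n i) :=
  if i < k then pi2 (τ.ass i) else ∅

variable {S : (i : ℕ) → AnnStack 𝒜 sharp φ i} {γ α : Γ} {p q : Q} {j : ℕ}
  {hk : 1 ≤ j + 1} {hn : j + 1 ≤ n} {hδ : 𝒜.δ γ p = .op q (.push (j + 1) hk hn α)}
  {τ : RunDesc Q M n 0}
  {hτ : τ.state = q} {D' : Deriv 𝒜 sharp φ α τ} {Φ : (i : ℕ) → Finset (M × RunDesc Q M n i)}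
  {hΦ : ∀ i, j + 1 < i → Φ i = ∅} {f : Flag} {hcomp : IsComposer 0 (j + 1) Φ (τ.ass (j + 1)) f}
  {E : (σ : RunDesc Q M n 0) → σ ∈ pi2 (Φ 0) → Deriv 𝒜 sharp φ γ σ}

section StackLemmas

variable {k : ℕ} {T : AnnStack 𝒜 sharp φ k}

theorem pushStack_zero (hk : 0 < k) : pushStack S D' k T 0 = .sym (.single D') := by
  rw [pushStack, Function.update_of_ne (by omega), Function.update_self]

theorem pushStack_self : pushStack S D' k T k = T := by
  rw [pushStack, Function.update_self]

theorem pushStack_of_lt {i : ℕ} (h0 : 0 < i) (hik : i < k) :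
    pushStack S D' k T i = restrict (S i) (upperAss τ k i) := by
  rw [pushStack, Function.update_of_ne (by omega), Function.update_of_ne (by omega), if_pos hik,
    upperAss, if_pos hik]

theorem pushStack_of_gt {i : ℕ} (hik : k < i) : pushStack S D' k T i = S i := by
  rw [pushStack, Function.update_of_ne (by omega), Function.update_of_ne (by omega),
    if_neg (by omega)]

end StackLemmas

/-- The contribution of the `i`-th components to a measure after a push. -/
noncomputable def pushWeight {N : Type*} [CommMonoid N] (μ : (k : ℕ) → AnnStack 𝒜 sharp φ k → N)
    (S : (i : ℕ) → AnnStack 𝒜 sharp φ i) (X : Finset (RunDesc Q M n 0)) (τ : RunDesc Q M n 0)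
    (k i : ℕ) : N :=
  (∏ ξ ∈ X, ∏ ρ ∈ pi2 (ξ.ass i), μ i (restrict (S i) {ρ})) *
    ∏ ρ ∈ upperAss τ k i, μ i (restrict (S i) {ρ})

theorem type_push (hS : S 0 = .sym (.single
    (Deriv.push γ p q (j + 1) hk hn α hδ τ hτ D' Φ hΦ f hcomp E)))
    (h : WellFormed (comp S 0 n)) {i : ℕ} (hi : 0 < i) (hij : i ≤ j + 1) :
    type (S i) = upperAss τ (j + 1) i ∪ (pi2 (Φ 0)).biUnion fun ξ => pi2 (ξ.ass i) := by
  rw [type_eq_pi2_ass h hS hi (by omega), ass_mk _ _ _ hi (by omega), ← hcomp.pi2_eq hi hij]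
  rcases Nat.lt_or_ge i (j + 1) with hlt | hge
  · rw [if_pos hlt, pi2_union, upperAss, if_pos hlt]
  · rw [if_neg (by omega), if_pos (by omega), upperAss, if_neg (by omega), Finset.empty_union]

theorem wellFormed_pushedStack
    (h' : WellFormed (comp (pushStack S D' (j + 1) (pushedStack S Φ γ E (j + 1))) 0 n))
    (hn : j + 1 ≤ n) : WellFormed (pushedStack S Φ γ E (j + 1)) := by
  have := h'.of_comp (Nat.zero_le n) (Nat.zero_le (j + 1)) hn
  rwa [pushStack_self] at this

theorem restrict_restrict_push (hcomp : IsComposer 0 (j + 1) Φ (τ.ass (j + 1)) f)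
    {ξ : RunDesc Q M n 0} (hξ : ξ ∈ pi2 (Φ 0)) {i : ℕ} (hi : 0 < i) (hij : i ≤ j + 1) :
    restrict (restrict (S i) (pi2 (Φ i))) (pi2 (ξ.ass i)) = restrict (S i) (pi2 (ξ.ass i)) := by
  refine restrict_restrict_of_subset _ ?_
  rw [hcomp.pi2_eq hi hij]
  exact Finset.subset_biUnion_of_mem (fun σ => pi2 (σ.ass i)) hξ

theorem pi2_ass_subset_type_push (hS : S 0 = .sym (.single
    (Deriv.push γ p q (j + 1) hk hn α hδ τ hτ D' Φ hΦ f hcomp E)))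
    (h : WellFormed (comp S 0 n)) {ξ : RunDesc Q M n 0} (hξ : ξ ∈ pi2 (Φ 0)) {i : ℕ} (hi : 0 < i)
    (hij : i ≤ j + 1) : pi2 (ξ.ass i) ⊆ type (S i) := by
  rw [type_push hS h hi hij]
  exact (Finset.subset_biUnion_of_mem (fun σ => pi2 (σ.ass i)) hξ).trans
    Finset.subset_union_right

theorem upperAss_subset_type_push (hS : S 0 = .sym (.single
    (Deriv.push γ p q (j + 1) hk hn α hδ τ hτ D' Φ hΦ f hcomp E)))
    (h : WellFormed (comp S 0 n)) {i : ℕ} (hi : 0 < i)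
    (hij : i ≤ j + 1) : upperAss τ (j + 1) i ⊆ type (S i) := by
  rw [type_push hS h hi hij]
  exact Finset.subset_union_left

theorem StackMeasure.iterOp_push_le {g : (γ : Γ) → DTree 𝒜 sharp φ γ → ℕ}
    {μ : (k : ℕ) → AnnStack 𝒜 sharp φ k → ℕ} (hμ : StackMeasure powTwo g μ)
    (hS : S 0 = .sym (.single
      (Deriv.push γ p q (j + 1) hk hn α hδ τ hτ D' Φ hΦ f hcomp E)))
    (h : WellFormed (comp S 0 n))
    (h' : WellFormed (comp (pushStack S D' (j + 1) (pushedStack S Φ γ E (j + 1))) 0 n)) :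
    iterOp powTwo (fun i => μ i (pushStack S D' (j + 1) (pushedStack S Φ γ E (j + 1)) i)) 0 (j + 1)
      ≤ iterOp powTwo (Function.update (pushWeight μ S (pi2 (Φ 0)) τ (j + 1)) 0
        (μ 0 (.sym (.ofFun γ (pi2 (Φ 0)) E)) * g α ⟨τ, D'⟩)) 0 (j + 1) := by
  have hwf := wellFormed_pushedStack h' hn
  have hW : ∀ i, 0 < i → i ≤ n → WellFormed (S i) := fun i _ hi =>
    h.of_comp (Nat.zero_le n) (Nat.zero_le i) hi
  have hT : μ (j + 1) (pushedStack S Φ γ E (j + 1)) ≤ iterOp powTwo (Function.update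
      (fun i => ∏ ξ ∈ pi2 (Φ 0), ∏ ρ ∈ pi2 (ξ.ass i), μ i (restrict (S i) {ρ})) 0
      (μ 0 (.sym (.ofFun γ (pi2 (Φ 0)) E)))) 0 (j + 1) := by
    rw [pushedStack] at hwf ⊢
    rw [hμ.comp_eq_prod hn hwf, Function.update_self, type_ofFun]
    refine (prod_iterOp_le _ _).trans_eq (iterOp_congr (Nat.zero_le _) fun i _ hi => ?_)
    rcases Nat.eq_zero_or_pos i with rfl | h0
    · rw [Function.update_self, hμ.eq_prod (wellFormed_sym _), type_ofFun]
      exact Finset.prod_congr rfl fun ξ _ => Function.update_self ..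
    · rw [Function.update_of_ne (by omega)]
      refine Finset.prod_congr rfl fun ξ hξ => ?_
      rw [Function.update_of_ne (by omega), Function.update_of_ne (by omega),
        restrict_restrict_push hcomp hξ h0 hi, hμ.restrict_eq_prod (hW i h0 (by omega))
        (pi2_ass_subset_type_push hS h hξ h0 hi)]
  rw [iterOp_succ (Nat.zero_le j), pushStack_self]
  refine (powTwo_mono hT le_rfl).trans ((powTwo_iterOp_le _ _ j).trans_eq ?_)
  rw [iterOp_succ (Nat.zero_le j)]
  congr 1
  · rw [Function.update_of_ne (by omega), Function.update_of_ne (by omega), pushWeight, upperAss,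
      if_neg (by omega), Finset.prod_empty, mul_one]
  · refine iterOp_congr (Nat.zero_le _) fun i _ hi => ?_
    rcases Nat.eq_zero_or_pos i with rfl | h0
    · rw [Function.update_self, Function.update_self, pushStack_zero (by omega), hμ.single]
    · rw [Function.update_of_ne (by omega), Function.update_of_ne (by omega),
        pushStack_of_lt h0 (by omega), pushWeight, hμ.restrict_eq_prod (hW i h0 (by omega))
        (upperAss_subset_type_push hS h h0 (by omega))]

theorem low_push (hS : S 0 = .sym (.single
      (Deriv.push γ p q (j + 1) hk hn α hδ τ hτ D' Φ hΦ f hcomp E)))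
    (h : WellFormed (comp S 0 n))
    (h' : WellFormed (comp (pushStack S D' (j + 1) (pushedStack S Φ γ E (j + 1))) 0 n)) :
    ∑ i ∈ Finset.Icc 0 (j + 1), low (pushStack S D' (j + 1) (pushedStack S Φ γ E (j + 1)) i) =
      (low (.sym (.ofFun γ (pi2 (Φ 0)) E) : AnnStack 𝒜 sharp φ 0) +
        (if τ.flag = .pr then 1 else 0)) +
      ∑ i ∈ Finset.Icc 1 (j + 1), ((∑ ξ ∈ pi2 (Φ 0), ∑ ρ ∈ pi2 (ξ.ass i),
        low (restrict (S i) {ρ})) + ∑ ρ ∈ upperAss τ (j + 1) i, low (restrict (S i) {ρ})) := by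
  have hwf := wellFormed_pushedStack h' hn
  have hW : ∀ i, 0 < i → i ≤ n → WellFormed (S i) := fun i _ hi =>
    h.of_comp (Nat.zero_le n) (Nat.zero_le i) hi
  have hsplit : ∀ (a : ℕ → ℕ) (m : ℕ), ∑ i ∈ Finset.Icc 0 m, a i =
      a 0 + ∑ i ∈ Finset.Icc 1 m, a i := fun a m =>
    (Finset.add_sum_Ioc_eq_sum_Icc (Nat.zero_le m)).symm
  have hT : low (pushedStack S Φ γ E (j + 1)) =
      low (.sym (.ofFun γ (pi2 (Φ 0)) E) : AnnStack 𝒜 sharp φ 0) +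
      ∑ i ∈ Finset.Icc 1 (j + 1), ∑ ξ ∈ pi2 (Φ 0), ∑ ρ ∈ pi2 (ξ.ass i),
        low (restrict (S i) {ρ}) := by
    rw [pushedStack] at hwf ⊢
    rw [low_comp_eq_sum hn hwf, Function.update_self, type_ofFun, Finset.sum_comm, hsplit]
    congr 1
    · rw [low_eq_sum (wellFormed_sym _), type_ofFun]
      simp only [if_true]
    · refine Finset.sum_congr rfl fun i hi => Finset.sum_congr rfl fun ξ hξ => ?_
      rw [Finset.mem_Icc] at hi
      rw [if_neg (by omega), Function.update_of_ne (by omega),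
        restrict_restrict_push hcomp hξ (by omega) hi.2,
        low_restrict_eq_sum (hW i (by omega) (by omega))
        (pi2_ass_subset_type_push hS h hξ (by omega) hi.2)]
  have hU : ∑ i ∈ Finset.Icc 1 (j + 1), ∑ ρ ∈ upperAss τ (j + 1) i, low (restrict (S i) {ρ}) =
      ∑ i ∈ Finset.Icc 1 j, low (pushStack S D' (j + 1) (pushedStack S Φ γ E (j + 1)) i) := by
    rw [Finset.sum_Icc_succ_top (by omega), upperAss, if_neg (by omega), Finset.sum_empty,
      add_zero]
    refine Finset.sum_congr rfl fun i hi => ?_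
    rw [Finset.mem_Icc] at hi
    rw [pushStack_of_lt (by omega) (by omega), low_restrict_eq_sum (hW i (by omega) (by omega))
      (upperAss_subset_type_push hS h (by omega) (by omega))]
  rw [Finset.sum_Icc_succ_top (by omega), hsplit, pushStack_self, pushStack_zero (by omega),
    low_single, hT, Finset.sum_add_distrib, hU]
  ring

end Push

section Push

variable {S : (i : ℕ) → AnnStack 𝒜 sharp φ i} {γ α : Γ} {p q : Q} {j : ℕ}
  {hk : 1 ≤ j + 1} {hn : j + 1 ≤ n} {hδ : 𝒜.δ γ p = .op q (.push (j + 1) hk hn α)}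
  {τ : RunDesc Q M n 0}
  {hτ : τ.state = q} {D' : Deriv 𝒜 sharp φ α τ} {Φ : (i : ℕ) → Finset (M × RunDesc Q M n i)}
  {hΦ : ∀ i, j + 1 < i → Φ i = ∅} {f : Flag} {hcomp : IsComposer 0 (j + 1) Φ (τ.ass (j + 1)) f}
  {E : (σ : RunDesc Q M n 0) → σ ∈ pi2 (Φ 0) → Deriv 𝒜 sharp φ γ σ}

/-- The nonproductivity condition for the tree of a push of order `k`. -/
def PushNp (τ : RunDesc Q M n 0) (Φ : (i : ℕ) → Finset (M × RunDesc Q M n i)) (f : Flag)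
    (k : ℕ) : Prop :=
  f = .np ∧ τ.flag = .np ∧ AllNp (pi2 (Φ 0)) ∧
    ∀ i, 1 ≤ i → i < k → AllNp (pi2 (τ.ass i) ∩ pi2 (Φ i))

theorem card_type_pushStack_zero {k : ℕ} (hk : 0 < k) {T : AnnStack 𝒜 sharp φ k} :
    (type (pushStack S D' k T 0)).card = 1 := by
  rw [pushStack_zero hk, card_type_single]

theorem low_push_le (hS : S 0 = .sym (.single
      (Deriv.push γ p q (j + 1) hk hn α hδ τ hτ D' Φ hΦ f hcomp E)))
    (h : WellFormed (comp S 0 n))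
    (h' : WellFormed (comp (pushStack S D' (j + 1) (pushedStack S Φ γ E (j + 1))) 0 n)) :
    low (comp S 0 n) ≤ low (comp (pushStack S D' (j + 1) (pushedStack S Φ γ E (j + 1))) 0 n) := by
  have hW : ∀ i, i ≤ n → WellFormed (S i) := fun i hi =>
    h.of_comp (Nat.zero_le n) (Nat.zero_le i) hi
  rw [low_comp (Nat.zero_le n) h (by rw [hS, card_type_single]),
    low_comp (Nat.zero_le n) h' (card_type_pushStack_zero (by omega))]
  have := sum_Icc_extend_le (f := fun i => low (S i))
    (g := fun i => low (pushStack S D' (j + 1) (pushedStack S Φ γ E (j + 1)) i)) (e := 0)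
    (Nat.zero_le (j + 1)) (Nat.zero_le (j + 1)) hn
    (fun i hi _ => by rw [pushStack_of_gt hi]) ?_
  · rwa [zero_add] at this
  rw [zero_add, low_push hS h h', ← Finset.add_sum_Ioc_eq_sum_Icc (Nat.zero_le (j + 1))]
  change _ + ∑ i ∈ Finset.Icc 1 (j + 1), low (S i) ≤ _
  have hle : ∀ i ∈ Finset.Icc 1 (j + 1), low (S i) ≤ (∑ ξ ∈ pi2 (Φ 0), ∑ ρ ∈ pi2 (ξ.ass i),
      low (restrict (S i) {ρ})) + ∑ ρ ∈ upperAss τ (j + 1) i, low (restrict (S i) {ρ}) := by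
    intro i hi
    rw [Finset.mem_Icc] at hi
    rw [low_eq_sum (hW i (by omega))]
    exact sum_overlap_le (type_push hS h hi.1 hi.2) _
  have hsum := Finset.sum_le_sum hle
  have hpos : ∀ i, 1 ≤ i → i ≤ j + 1 → ∀ ρ ∈ type (S i), ρ.flag ≠ .np →
      1 ≤ low (restrict (S i) {ρ}) := fun i h1 h2 ρ hρ hf =>
    one_le_low_restrict_singleton (hW i (by omega)) hρ (Flag.ne_np.1 hf)
  rw [hS, low_single, flag_mk]
  by_cases hnp : PushNp τ Φ f (j + 1)
  · rw [if_neg (by rw [if_pos (by exact hnp)]; simp), zero_add]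
    omega
  rw [if_pos (if_neg (by exact hnp))]
  by_cases h1 : τ.flag = .np
  swap
  · rw [if_pos (Flag.ne_np.1 h1)]
    omega
  by_cases h2 : AllNp (pi2 (Φ 0))
  swap
  · unfold AllNp at h2
    push Not at h2
    obtain ⟨ξ, hξ, hf⟩ := h2
    have : 1 ≤ low (.sym (.ofFun γ (pi2 (Φ 0)) E) : AnnStack 𝒜 sharp φ 0) := by
      rw [low, type_ofFun]
      exact Finset.card_pos.2 ⟨ξ, Finset.mem_filter.2 ⟨hξ, Flag.ne_np.1 hf⟩⟩
    omega
  suffices hex : ∃ i ∈ Finset.Icc 1 (j + 1), low (S i) < (∑ ξ ∈ pi2 (Φ 0), ∑ ρ ∈ pi2 (ξ.ass i),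
      low (restrict (S i) {ρ})) + ∑ ρ ∈ upperAss τ (j + 1) i, low (restrict (S i) {ρ}) by
    have := Finset.sum_lt_sum hle hex
    omega
  by_cases h3 : f = .np
  · have h4 : ¬ ∀ i, 1 ≤ i → i < j + 1 → AllNp (pi2 (τ.ass i) ∩ pi2 (Φ i)) := fun h4 =>
      hnp ⟨h3, h1, h2, h4⟩
    unfold AllNp at h4
    push Not at h4
    obtain ⟨i, hi1, hi2, ρ, hρ, hf⟩ := h4
    refine ⟨i, Finset.mem_Icc.2 ⟨hi1, by omega⟩, ?_⟩
    rw [low_eq_sum (hW i (by omega))]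
    have hρ' : ρ ∈ upperAss τ (j + 1) i ∩ (pi2 (Φ 0)).biUnion fun ξ => pi2 (ξ.ass i) := by
      rwa [upperAss, if_pos hi2, ← hcomp.pi2_eq hi1 (by omega)]
    refine sum_overlap_lt_of_mem_inter (type_push hS h hi1 (by omega)) hρ'
      (hpos i hi1 (by omega) ρ ?_ hf)
    exact upperAss_subset_type_push hS h hi1 (by omega) (Finset.mem_inter.1 hρ').1
  · rw [hcomp.flag_iff] at h3
    unfold AllNp at h3
    push Not at h3
    obtain ⟨i, hi1, hi2, ξ, hξ, η, hη, hne, ρ, hρ, hf⟩ := h3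
    refine ⟨i, Finset.mem_Icc.2 ⟨hi1, hi2⟩, ?_⟩
    rw [low_eq_sum (hW i (by omega))]
    rw [Finset.mem_inter] at hρ
    exact sum_overlap_lt_of_mem_of_mem (type_push hS h hi1 hi2) hξ hη hne hρ.1 hρ.2
      (hpos i hi1 hi2 ρ (pi2_ass_subset_type_push hS h hξ hi1 hi2 hρ.1) hf)

theorem card_le_natCard {α : Type*} [Finite α] (s : Finset α) : s.card ≤ Nat.card α := by
  have := Fintype.ofFinite α
  rw [Nat.card_eq_fintype_card]
  exact s.card_le_univ

theorem StackMeasure.push_lt [Finite Q] [Finite M] {g : (γ : Γ) → DTree 𝒜 sharp φ γ → ℕ}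
    {μ : (k : ℕ) → AnnStack 𝒜 sharp φ k → ℕ} (hμ : StackMeasure powTwo g μ)
    (hg : ∀ γ D, 1 ≤ g γ D) (hgw : ∀ γ D, g γ D ≤ D.weight)
    (hS : S 0 = .sym (.single (Deriv.push γ p q (j + 1) hk hn α hδ τ hτ D' Φ hΦ f hcomp E)))
    (hgS : g γ ⟨_, Deriv.push γ p q (j + 1) hk hn α hδ τ hτ D' Φ hΦ f hcomp E⟩ =
      DTree.weight ⟨_, Deriv.push γ p q (j + 1) hk hn α hδ τ hτ D' Φ hΦ f hcomp E⟩)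
    (h : WellFormed (comp S 0 n))
    (h' : WellFormed (comp (pushStack S D' (j + 1) (pushedStack S Φ γ E (j + 1))) 0 n)) :
    μ n (comp (pushStack S D' (j + 1) (pushedStack S Φ γ E (j + 1))) 0 n) < μ n (comp S 0 n) := by
  have : Nonempty (RunDesc Q M n 0) := ⟨τ⟩
  have ht : 1 ≤ Nat.card (RunDesc Q M n 0) := Nat.card_pos
  have hW : ∀ i, i ≤ n → WellFormed (S i) := fun i hi =>
    h.of_comp (Nat.zero_le n) (Nat.zero_le i) hi
  have hX := card_le_natCard (pi2 (Φ 0))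
  have hpos : ∀ {k : ℕ} (s : AnnStack 𝒜 sharp φ k), 1 ≤ μ k s := fun s => hμ.one_le hg s
  rw [hμ.comp_of_singleton (Nat.zero_le n) h (by rw [hS, card_type_single]),
    hμ.comp_of_singleton (Nat.zero_le n) h' (card_type_pushStack_zero (by omega))]
  refine iterOp_extend_lt (Nat.zero_le (j + 1)) (Nat.zero_le (j + 1)) hn
    (fun i hi _ => by rw [pushStack_of_gt hi]) (fun i _ _ => hpos _)
    ((hμ.iterOp_push_le hS h h').trans_lt ?_)
  set z := max D'.depth ((pi2 (Φ 0)).attach.sup fun σ => (E σ.1 σ.2).depth) with hz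
  set t := Nat.card (RunDesc Q M n 0) with ht'
  refine iterOp_push_lt (t := t) (n := n) (c := constC n t z ^ (t + 1)) ht hn ?_
    (fun i _ _ => hpos _) ?_ ?_ ?_ ?_
  · exact Nat.one_le_pow _ _ (lt_of_lt_of_le two_pos (two_le_constC ht z))
  · intro i h0 hi
    rw [Function.update_of_ne (by omega), pushWeight, hμ.eq_prod (hW i (by omega))]
    refine prod_overlap_le (type_push hS h h0 (by omega)) (fun ρ _ => hpos _) ?_
    split_ifs <;> omega
  · rw [Function.update_of_ne (by omega), pushWeight, hμ.eq_prod (hW (j + 1) hn)]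
    refine prod_overlap_le (type_push hS h (by omega) le_rfl) (fun ρ _ => hpos _) ?_
    rw [if_pos (by rw [upperAss, if_neg (by omega)])]
    omega
  · rw [Function.update_self, pow_succ]
    refine Nat.mul_le_mul ?_ ((hgw _ _).trans (constC_mono ht (le_max_left _ _)))
    rw [hμ.sym]
    refine (Finset.prod_le_pow_card _ _ (constC n t z) fun D hD => ?_).trans
      (Nat.pow_le_pow_right (lt_of_lt_of_le two_pos (two_le_constC ht z)) ?_)
    · obtain ⟨σ, hσ, rfl⟩ := Finset.mem_image.1 hD
      refine (hgw _ _).trans (constC_mono ht (le_trans ?_ (le_max_right _ _)))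
      exact Finset.le_sup (f := fun σ : {σ // σ ∈ pi2 (Φ 0)} => (E σ.1 σ.2).depth) hσ
    · refine Finset.card_image_le.trans ?_
      rwa [Finset.card_attach]
  · simp only [hS]
    rw [hμ.single, hgS, DTree.weight, Deriv.depth, ← hz, ← ht', add_comm, constC]

theorem len_push_lt [Finite Q] [Finite M] (hS : S 0 = .sym (.single
      (Deriv.push γ p q (j + 1) hk hn α hδ τ hτ D' Φ hΦ f hcomp E)))
    (h : WellFormed (comp S 0 n))
    (h' : WellFormed (comp (pushStack S D' (j + 1) (pushedStack S Φ γ E (j + 1))) 0 n)) :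
    len (comp (pushStack S D' (j + 1) (pushedStack S Φ γ E (j + 1))) 0 n) < len (comp S 0 n) :=
  len_isStackMeasure.push_lt (fun _ D => one_le_two.trans (two_le_weight D)) (fun _ _ => le_rfl)
    hS rfl h h'

theorem high_push_ge [Finite Q] [Finite M] (hS : S 0 = .sym (.single
      (Deriv.push γ p q (j + 1) hk hn α hδ τ hτ D' Φ hΦ f hcomp E)))
    (h : WellFormed (comp S 0 n))
    (h' : WellFormed (comp (pushStack S D' (j + 1) (pushedStack S Φ γ E (j + 1))) 0 n)) :
    high (comp (pushStack S D' (j + 1) (pushedStack S Φ γ E (j + 1))) 0 n) ≤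
      high (comp S 0 n) := by
  by_cases hnp : PushNp τ Φ f (j + 1)
  swap
  · refine (high_isStackMeasure.push_lt (fun _ D => ?_) (fun _ D => ?_) hS ?_ h h').le
    · have := two_le_weight D
      split_ifs <;> omega
    · have := two_le_weight D
      split_ifs <;> omega
    · rw [if_pos]
      rw [flag_mk]
      exact if_neg hnp
  obtain ⟨h1, h2, h3, h4⟩ := id hnp
  have hW : ∀ i, i ≤ n → WellFormed (S i) := fun i hi =>
    h.of_comp (Nat.zero_le n) (Nat.zero_le i) hi
  have hone : ∀ i, i ≤ n → ∀ ρ ∈ type (S i), ρ.flag = .np → high (restrict (S i) {ρ}) = 1 :=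
    fun i hi ρ hρ hf => high_isStackMeasure.restrict_singleton_of_np (powTwo_one_right 1)
      (fun _ D hD => by simp [hD]) (hW i hi) hρ hf
  rw [high_comp (Nat.zero_le n) h (by rw [hS, card_type_single]),
    high_comp (Nat.zero_le n) h' (card_type_pushStack_zero (by omega))]
  refine iterOp_extend_le (Nat.zero_le (j + 1)) (Nat.zero_le (j + 1)) hn
    (fun i hi _ => by rw [pushStack_of_gt hi])
    ((high_isStackMeasure.iterOp_push_le hS h h').trans_eq
      (iterOp_congr (Nat.zero_le _) fun i _ hi => ?_))
  rcases Nat.eq_zero_or_pos i with rfl | h0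
  · have hS0 : high (S 0) = 1 := by
      rw [hS, high_single, flag_mk, if_neg]
      rw [if_pos (by exact hnp)]
      simp
    rw [Function.update_self, hS0, if_neg (by simp [h2]), mul_one, high_isStackMeasure.sym]
    refine Finset.prod_eq_one fun D hD => ?_
    obtain ⟨σ, hσ, rfl⟩ := Finset.mem_image.1 hD
    rw [if_neg]
    rw [h3 σ.1 σ.2]
    simp
  · rw [Function.update_of_ne (by omega), pushWeight,
      high_isStackMeasure.eq_prod (hW i (by omega))]
    refine prod_overlap_eq (type_push hS h h0 hi) (fun ξ hξ η hη hne ρ hρ => ?_) fun ρ hρ => ?_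
    · exact hone i (by omega) ρ (pi2_ass_subset_type_push hS h hξ h0 hi (Finset.mem_inter.1 hρ).1)
        (hcomp.flag_iff.1 h1 i h0 hi ξ hξ η hη hne ρ hρ)
    · refine hone i (by omega) ρ
        (upperAss_subset_type_push hS h h0 hi (Finset.mem_inter.1 hρ).1) ?_
      rw [← hcomp.pi2_eq h0 hi] at hρ
      rcases Nat.lt_or_ge i (j + 1) with hlt | hge
      · rw [upperAss, if_pos hlt] at hρ
        exact h4 i h0 hlt ρ hρ
      · rw [upperAss, if_neg (by omega), Finset.empty_inter] at hρ
        exact absurd hρ (Finset.notMem_empty ρ)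

end Push

/-! ### Steps of annotated runs -/

theorem conf_state {S : (i : ℕ) → AnnStack 𝒜 sharp φ i} {l : ℕ} (hl : l ≤ n)
    {σ : RunDesc Q M n l} (hσ : type (S l) = {σ}) (hp : (comp S l n).Proper)
    (hs : Singular (comp S l n)) : (conf (comp S l n) hp hs).state = σ.state := by
  have h : (Finset.card_eq_one.1 hs).choose ∈ type (comp S l n) :=
    (Finset.ext_iff.1 (Finset.card_eq_one.1 hs).choose_spec _).2 (Finset.mem_singleton_self _)
  obtain ⟨ρ, hρ, hst⟩ := exists_state_eq_of_mem_type_comp hl h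
  rw [hσ, Finset.mem_singleton] at hρ
  rw [conf, hst, hρ]

theorem conf_stack (S : (i : ℕ) → AnnStack 𝒜 sharp φ i) (hp : (comp S 0 n).Proper)
    (hs : Singular (comp S 0 n)) :
    (conf (comp S 0 n) hp hs).stack = comp (fun i => st (S i)) 0 n :=
  map_comp _ _ (Nat.zero_le n)

theorem trans_conf {S : (i : ℕ) → AnnStack 𝒜 sharp φ i} {γ : Γ} {σ : RunDesc Q M n 0}
    {D : Deriv 𝒜 sharp φ γ σ} (hS : S 0 = .sym (.single D)) (hp : (comp S 0 n).Proper)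
    (hs : Singular (comp S 0 n)) :
    𝒜.trans (conf (comp S 0 n) hp hs) = some (𝒜.δ γ σ.state) := by
  rw [DPDA.trans, conf_state (Nat.zero_le n) (by rw [hS, type_single]) hp hs, conf_stack,
    topSym_comp _ (Nat.zero_le n), hS]
  rfl

theorem stepWord_of_read {c d : Config n Γ Q} {r : A ↪ Q} {a : A}
    (hc : 𝒜.trans c = some (.read r)) (hd : d.state = r a) : 𝒜.stepWord c d = [a] := by
  have hex : ∃ a, d.state = r a := ⟨a, hd⟩
  simp only [DPDA.stepWord, hc, dif_pos hex]
  rw [r.injective (hex.choose_spec.symm.trans hd)]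

theorem stepWord_of_op {c d : Config n Γ Q} {q : Q} {o : StackOp n Γ}
    (hc : 𝒜.trans c = some (.op q o)) : 𝒜.stepWord c d = [] := by
  simp only [DPDA.stepWord, hc]

theorem st_pushStack (S : (i : ℕ) → AnnStack 𝒜 sharp φ i) {γ α : Γ} {τ : RunDesc Q M n 0}
    (D' : Deriv 𝒜 sharp φ α τ) {k : ℕ} (hk : 0 < k)
    (Φ : (i : ℕ) → Finset (M × RunDesc Q M n i))
    (E : (σ : RunDesc Q M n 0) → σ ∈ pi2 (Φ 0) → Deriv 𝒜 sharp φ γ σ)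
    (hS : st (S 0) = .sym γ) (i : ℕ) :
    st (pushStack S D' k (pushedStack S Φ γ E k) i) =
      Function.update (Function.update (fun i => st (S i)) 0 (.sym α)) k
        (comp (fun i => st (S i)) 0 k) i := by
  rcases lt_trichotomy i k with hi | rfl | hi
  · rw [Function.update_of_ne (by omega)]
    rcases Nat.eq_zero_or_pos i with rfl | h0
    · rw [pushStack_zero hk, Function.update_self]
      rfl
    · rw [pushStack_of_lt h0 hi, Function.update_of_ne (by omega), st_restrict]
  · rw [pushStack_self, Function.update_self, pushedStack, st, map_comp _ _ (Nat.zero_le _)]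
    refine comp_congr (Nat.zero_le _) fun l _ _ => ?_
    rcases Nat.eq_zero_or_pos l with rfl | h0
    · rw [Function.update_self, hS]
      rfl
    · rw [Function.update_of_ne (by omega)]
      exact st_restrict _ _
  · rw [pushStack_of_gt hi, Function.update_of_ne (by omega), Function.update_of_ne (by omega)]

theorem IsAnnSucc.step [Finite Q] [Finite M] {s t : AnnStack 𝒜 sharp φ n} (h : IsAnnSucc s t)
    (hps : s.Proper) (hpt : t.Proper) (hws : WellFormed s) (hwt : WellFormed t)
    (hss : Singular s) (hst : Singular t) :
    𝒜.IsSucc (conf s hps hss) (conf t hpt hst) ∧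
    low s ≤ (𝒜.stepWord (conf s hps hss) (conf t hpt hst)).count sharp + low t ∧
    (𝒜.stepWord (conf s hps hss) (conf t hpt hst)).count sharp + high t ≤ high s ∧
    1 + len t ≤ len s := by
  obtain ⟨S, γ, σ, D, rfl, hS, hD⟩ := h
  have htr := trans_conf hS hps hss
  cases D with
  | empty => simp [Deriv.next] at hD
  | read _ p r hδ a τ hτ D' =>
    obtain rfl := Option.some.inj hD
    rw [state_mk, hδ] at htr
    have hst' := (conf_state (Nat.zero_le n) (by rw [Function.update_self, type_single]) hpt hst).trans hτ
    have hcount : ([a] : List A).count sharp = if a = sharp then 1 else 0 := by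
      simp [List.count_singleton]
    rw [stepWord_of_read htr hst', hcount]
    refine ⟨Or.inl ⟨r, a, htr, hst', ?_⟩, low_read_le hS hws hwt, high_read_ge hS hws hwt, ?_⟩
    · rw [conf_stack, conf_stack]
      refine comp_congr (Nat.zero_le n) fun i _ _ => ?_
      rcases Nat.eq_zero_or_pos i with rfl | h0
      · rw [Function.update_self, hS]
        rfl
      · rw [Function.update_of_ne (by omega)]
    · have := len_read_lt hS hws hwt
      omega
  | pop _ p q k hk hn hδ τ hτ =>
    obtain rfl := Option.some.inj hD
    rw [state_mk, hδ] at htr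
    rw [stepWord_of_op htr, List.count_nil, zero_add, zero_add]
    refine ⟨Or.inr ⟨q, _, htr, ?_, fun i => st (S i), conf_stack _ _ _, ?_, map_comp _ _ hn⟩,
      low_pop_le hS hws hwt, high_pop_ge hS hws hwt, ?_⟩
    · rw [conf_state hn (type_pop_self hS hws), hτ]
    · exact map_nonempty _ _ (nonempty_of_proper_comp S hn hpt hst.nonempty)
    · have := len_pop_lt hS hws hwt
      omega
  | push _ p q k hk hn α hδ τ hτ D' Φ hΦ f hcomp E =>
    obtain ⟨j, rfl⟩ := Nat.exists_eq_add_of_le' hk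
    obtain rfl : comp (pushStack S D' (j + 1) (pushedStack S Φ γ E (j + 1))) 0 n = t :=
      Option.some.inj hD
    rw [state_mk, hδ] at htr
    rw [stepWord_of_op htr, List.count_nil, zero_add, zero_add]
    refine ⟨Or.inr ⟨q, _, htr, ?_, fun i => st (S i), conf_stack _ _ _, ?_⟩,
      low_push_le hS hws hwt, high_push_ge hS hws hwt, ?_⟩
    · rw [conf_state (Nat.zero_le n) (by rw [pushStack_zero (by omega), type_single]), hτ]
    · rw [conf_stack]
      refine comp_congr (Nat.zero_le n) fun i _ _ => ?_
      exact st_pushStack S D' (by omega) Φ E (by rw [hS]; rfl) i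
    · have := len_push_lt hS hws hwt
      omega

theorem Fin.le_sum_add_last {m : ℕ} (a : Fin (m + 1) → ℕ) (e : Fin m → ℕ)
    (h : ∀ i : Fin m, a i.castSucc ≤ e i + a i.succ) : a 0 ≤ ∑ i, e i + a (Fin.last m) := by
  induction m with
  | zero => simp
  | succ m ih =>
    have h1 := ih (fun i => a i.succ) (fun i => e i.succ) fun i => h i.succ
    have h2 := h 0
    rw [Fin.sum_univ_succ]
    simp only [Fin.castSucc_zero, Fin.succ_last, Nat.succ_eq_add_one] at h1 h2
    omega

theorem Fin.sum_add_last_le {m : ℕ} (a : Fin (m + 1) → ℕ) (e : Fin m → ℕ)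
    (h : ∀ i : Fin m, e i + a i.succ ≤ a i.castSucc) : ∑ i, e i + a (Fin.last m) ≤ a 0 := by
  induction m with
  | zero => simp
  | succ m ih =>
    have h1 := ih (fun i => a i.succ) (fun i => e i.succ) fun i => h i.succ
    have h2 := h 0
    rw [Fin.sum_univ_succ]
    simp only [Fin.castSucc_zero, Fin.succ_last, Nat.succ_eq_add_one] at h1 h2
    omega

theorem sharps_eq_sum (sharp : A) {m : ℕ} (c : Fin (m + 1) → Config n Γ Q) :
    𝒜.sharps sharp c = ∑ i : Fin m, (𝒜.stepWord (c i.castSucc) (c i.succ)).count sharp := by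
  rw [DPDA.sharps, DPDA.word, List.count_flatten, List.map_ofFn, List.sum_ofFn]
  rfl

end HOPDA

theorem mainTheorem7 {n : ℕ} {A Γ Q M : Type*} [Finite Q] [Monoid M] [Finite M]
    (𝒜 : HOPDA.DPDA n A Γ Q) (sharp : A) (φ : FreeMonoid A →* M)
    (R : HOPDA.AnnRun 𝒜 sharp φ) :
    𝒜.IsRun R.st ∧
    HOPDA.low (R.stk 0) ≤ 𝒜.sharps sharp R.st + HOPDA.low (R.stk (Fin.last R.length)) ∧
    HOPDA.high (R.stk 0) ≥ 𝒜.sharps sharp R.st + HOPDA.high (R.stk (Fin.last R.length)) ∧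
    HOPDA.len (R.stk 0) ≥ R.length + HOPDA.len (R.stk (Fin.last R.length)) := by
  have hstep := fun i : Fin R.length => (R.succ i).step (R.proper _) (R.proper _)
    (R.wellFormed _) (R.wellFormed _) (R.singular _) (R.singular _)
  rw [HOPDA.sharps_eq_sum]
  refine ⟨fun i => (hstep i).1, ?_, ?_, ?_⟩
  · exact HOPDA.Fin.le_sum_add_last (fun i => HOPDA.low (R.stk i)) _ fun i => (hstep i).2.1
  · exact HOPDA.Fin.sum_add_last_le (fun i => HOPDA.high (R.stk i)) _ fun i => (hstep i).2.2.1
  · have := HOPDA.Fin.sum_add_last_le (fun i => HOPDA.len (R.stk i)) (fun _ => 1)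
      fun i => (hstep i).2.2.2
    simpa using this
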